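/- All groups are finite. A class of groups is a non-empty, isomorphism-closed family of finite groups; $\pi$ is a set of primes and $\pi'$ its complement in the set of all primes. A formation is a class closed under homomorphic images and subdirect products; $G^{\mathfrak F}$ is the smallest normal subgroup $N$ of $G$ with $G/N\in\mathfrak F$, and $\mathfrak X\circ\mathfrak F=\{G : G^{\mathfrak F}\in\mathfrak X\}$. Let $\mathfrak N$, $\mathfrak N_\pi$ and $\mathfrak G_p$ be the classes of nilpotent groups, of $\pi$-nilpotent groups (those with a normal $\pi'$-subgroup with nilpotent quotient) and of $p$-groups, and let $O_{\pi'}(G)$ be the largest normal $\pi'$-subgroup of $G$. For a formation $\mathfrak F$ and a group $G$ put: - $\mathcal N_{\pi'\mathfrak F}(G)=\bigcap_{H\le G}N_G\bigl(H^{\mathfrak F}O_{\pi'}(G)\bigr)$, $\mathcal N^0_{\pi'\mathfrak F}(G)=1$, $\mathcal N^{i}_{\pi'\mathfrak F}(G)/\mathcal N^{i-1}_{\pi'\mathfrak F}(G)=\mathcal N_{\pi'\mathfrak F}\bigl(G/\mathcal N^{i-1}_{\pi'\mathfrak F}(G)\bigr)$ for $i\ge 1$, and let $\mathcal N^\infty_{\pi'\mathfrak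 F}(G)$ be the terminal term of this ascending series. - $Z_{\pi(\mathfrak N\circ\mathfrak F)}(G)$ is the product of all normal subgroups $N$ of $G$ such that every chief factor $L/K$ of $G$ with $L\le N$ and with order divisible by some prime in $\pi$ satisfies $(L/K)\rtimes(G/C_G(L/K))\in\mathfrak N\circ\mathfrak F$ (action by conjugation). - $\mathrm{Int}_{\mathfrak X}(G)$, for a class $\mathfrak X$, is the intersection of all $\mathfrak X$-maximal subgroups of $G$, i.e. of the subgroups in $\mathfrak X$ not properly contained in another subgroup in $\mathfrak X$. **Theorem C.** Let $\pi$ be a set of primes and let $\mathfrak F$ be a formation closed under taking subgroups. Then the following are equivalent: 1. $\mathcal N^\infty_{\pi'\mathfrak F}(G)=\mathrm{Int}_{\mathfrak N_\pi\circ\mathfrak F}(G)$ for every group $G$. 2. $Z_{\pi(\mathfrak N\circ\mathfrak F)}(G)=\mathrm{Int}_{\mathfrak N_\pi\circ\mathfrak F}(G)$ for every group $G$. 3. $\mathfrak F$ satisfies the $\pi$-boundary condition (III): for every $p\in\pi$, each group that does not lie in $\mathfrak G_p\circ\mathfrak F$ but all of whose proper subgroups lie in $\mathfrak G_p\circ\mathfrak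 F$ belongs to $\mathfrak N_\pi\circ\mathfrak F$. -/

import Mathlib

universe u

/-- A class of finite groups: a property of finite groups that is invariant under isomorphism. -/
structure GroupClass : Type (u + 1) where
  Mem : ∀ (G : Type u) [Group G] [Finite G], Prop
  mem_of_mulEquiv : ∀ {G H : Type u} [Group G] [Finite G] [Group H] [Finite H],
    (G ≃* H) → Mem G → Mem H

namespace GroupClass

/-- A formation: a non-empty class of finite groups closed under homomorphic images and under
subdirect products (`G` is a subdirect product of `A` and `B` when it maps onto both and the two
kernels meet trivially). -/
structure IsFormation (F : GroupClass.{u}) : Prop where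
  nonempty : ∃ (G : Type u) (_ : Group G) (_ : Finite G), F.Mem G
  image : ∀ {G H : Type u} [Group G] [Finite G] [Group H] [Finite H] (f : G →* H),
    Function.Surjective f → F.Mem G → F.Mem H
  subdirect : ∀ {G A B : Type u} [Group G] [Finite G] [Group A] [Finite A] [Group B] [Finite B]
    (f : G →* A) (g : G →* B), Function.Surjective f → Function.Surjective g →
    f.ker ⊓ g.ker = ⊥ → F.Mem A → F.Mem B → F.Mem G

/-- Closure under subgroups. -/
def IsSubgroupClosed (F : GroupClass.{u}) : Prop :=
  ∀ (G : Type u) [Group G] [Finite G] (H : Subgroup G), F.Mem G → F.Mem H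

/-- The class of finite nilpotent groups. -/
def nilpotent : GroupClass.{u} where
  Mem G _ _ := Group.IsNilpotent G
  mem_of_mulEquiv e h := by
    have := h
    exact Group.nilpotent_of_mulEquiv e

/-- The class of finite `π`-groups: every prime divisor of the order lies in `π`. -/
def piGroups (π : Set Nat.Primes) : GroupClass.{u} where
  Mem G _ _ := ∀ p : Nat.Primes, (p : ℕ) ∣ Nat.card G → p ∈ π
  mem_of_mulEquiv e h p hp := h p (by rwa [Nat.card_congr e.toEquiv])

/-- The class of finite `π`-nilpotent groups: the extensions of a (normal) `π'`-group by a
nilpotent group. -/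
def piNilpotent (π : Set Nat.Primes) : GroupClass.{u} where
  Mem G _ _ := ∃ (N : Subgroup G) (_ : N.Normal),
    (piGroups πᶜ).Mem N ∧ nilpotent.Mem (G ⧸ N)
  mem_of_mulEquiv e h := by
    obtain ⟨N, hN, h1, h2⟩ := h
    have : (N.map e.toMonoidHom).Normal := hN.map _ e.surjective
    exact ⟨N.map e.toMonoidHom, inferInstance,
      (piGroups πᶜ).mem_of_mulEquiv (e.subgroupMap N) h1,
      nilpotent.mem_of_mulEquiv (QuotientGroup.congr N (N.map e.toMonoidHom) e rfl) h2⟩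

section Residual

variable (F : GroupClass.{u})

/-- The `F`-residual of `G`, the smallest normal subgroup with quotient in `F`
(for a formation `F` this intersection has its quotient in `F`). -/
def residual (G : Type u) [Group G] [Finite G] : Subgroup G :=
  sInf {N | ∃ _ : N.Normal, F.Mem (G ⧸ N)}

theorem residual_le_comap {G H : Type u} [Group G] [Finite G] [Group H] [Finite H] (e : G ≃* H) :
    F.residual G ≤ (F.residual H).comap (e : G →* H) := by
  rw [← Subgroup.map_le_iff_le_comap]
  refine le_sInf ?_
  rintro N ⟨hN, hF⟩
  rw [Subgroup.map_le_iff_le_comap]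
  refine sInf_le ⟨hN.comap _, ?_⟩
  refine F.mem_of_mulEquiv (QuotientGroup.congr _ _ e ?_).symm hF
  exact Subgroup.map_comap_eq_self_of_surjective e.surjective N

theorem residual_map {G H : Type u} [Group G] [Finite G] [Group H] [Finite H] (e : G ≃* H) :
    (F.residual G).map (e : G →* H) = F.residual H := by
  apply le_antisymm
  · exact Subgroup.map_le_iff_le_comap.2 (F.residual_le_comap e)
  · intro x hx
    exact ⟨e.symm x, F.residual_le_comap e.symm hx, by simp⟩

/-- The `F`-residual of a subgroup `K` of `G`, as a subgroup of `G`. -/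
def subgroupResidual {G : Type u} [Group G] [Finite G] (K : Subgroup G) : Subgroup G :=
  (F.residual K).map K.subtype

theorem subgroupResidual_map {G H : Type u} [Group G] [Finite G] [Group H] [Finite H]
    (e : G ≃* H) (K : Subgroup G) :
    (F.subgroupResidual K).map (e : G →* H) = F.subgroupResidual (K.map (e : G →* H)) := by
  have h : (F.residual K).map (e.subgroupMap K : _ →* _) =
      F.residual (K.map (e : G →* H)) := F.residual_map (e.subgroupMap K)
  rw [subgroupResidual, subgroupResidual, ← h, Subgroup.map_map, Subgroup.map_map]
  rfl

/-- The `X`-radical of `G`: the product of all normal `X`-subgroups of `G`. -/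
def radical (X : GroupClass.{u}) (G : Type u) [Group G] [Finite G] : Subgroup G :=
  sSup {N | N.Normal ∧ X.Mem N}

theorem radical_map_le (X : GroupClass.{u}) {G H : Type u} [Group G] [Finite G] [Group H]
    [Finite H] (e : G ≃* H) : (X.radical G).map (e : G →* H) ≤ X.radical H := by
  rw [Subgroup.map_le_iff_le_comap]
  refine sSup_le ?_
  rintro N ⟨hN, hX⟩
  rw [← Subgroup.map_le_iff_le_comap]
  exact le_sSup ⟨hN.map _ e.surjective, X.mem_of_mulEquiv (e.subgroupMap N) hX⟩

theorem radical_map (X : GroupClass.{u}) {G H : Type u} [Group G] [Finite G] [Group H]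
    [Finite H] (e : G ≃* H) : (X.radical G).map (e : G →* H) = X.radical H := by
  apply le_antisymm (X.radical_map_le e)
  intro x hx
  exact ⟨e.symm x, X.radical_map_le e.symm ⟨x, hx, rfl⟩, by simp⟩

end Residual

/-- The formation product `X ∘ F`: the groups whose `F`-residual lies in `X`. -/
def formationProduct (X F : GroupClass.{u}) : GroupClass.{u} where
  Mem G _ _ := X.Mem (F.residual G)
  mem_of_mulEquiv e h := by
    refine X.mem_of_mulEquiv ((e.subgroupMap _).trans (MulEquiv.subgroupCongr ?_)) h
    exact F.residual_map e

section Norm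

variable (X F : GroupClass.{u})

/-- The `X`-`F`-norm of `G`: the intersection, over all subgroups `K` of `G`, of the normalizers
of the products of the `F`-residual of `K` and the `X`-radical of `G`. -/
def norm (G : Type u) [Group G] [Finite G] : Subgroup G :=
  ⨅ K : Subgroup G,
    Subgroup.normalizer ((F.subgroupResidual K ⊔ X.radical G : Subgroup G) : Set G)

instance norm_normal (G : Type u) [Group G] [Finite G] : (norm X F G).Normal := by
  refine ⟨fun n hn g => ?_⟩
  simp only [norm, Subgroup.mem_iInf] at hn ⊢
  intro K
  have h := hn (K.map ((MulAut.conj g⁻¹ : G ≃* G) : G →* G))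
  have h2 : (F.subgroupResidual K ⊔ X.radical G).map ((MulAut.conj g⁻¹ : G ≃* G) : G →* G) =
      F.subgroupResidual (K.map ((MulAut.conj g⁻¹ : G ≃* G) : G →* G)) ⊔ X.radical G := by
    rw [Subgroup.map_sup, F.subgroupResidual_map, X.radical_map]
  have h3 := Subgroup.map_equiv_normalizer_eq (F.subgroupResidual K ⊔ X.radical G)
    (MulAut.conj g⁻¹ : G ≃* G)
  rw [← h2] at h
  replace h := h3.ge h
  obtain ⟨y, hy, hyn⟩ := h
  have : y = g * n * g⁻¹ := by
    rw [← hyn]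
    simp [mul_assoc]
  exact this ▸ hy

/-- The ascending series of `X`-`F`-norms, together with the normality of its terms: it starts
at `1`, and the quotient of consecutive terms is the `X`-`F`-norm of `G` modulo the former one. -/
def normSeriesAux (G : Type u) [Group G] [Finite G] : ℕ → {N : Subgroup G // N.Normal}
  | 0 => ⟨⊥, inferInstance⟩
  | i + 1 =>
    haveI := (normSeriesAux G i).2
    ⟨(norm X F (G ⧸ (normSeriesAux G i).1)).comap (QuotientGroup.mk' (normSeriesAux G i).1),
      inferInstance⟩

/-- The `i`-th term of the ascending series of `X`-`F`-norms of `G`. -/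
def normSeries (G : Type u) [Group G] [Finite G] (i : ℕ) : Subgroup G :=
  (normSeriesAux X F G i).1

/-- The terminal term of the ascending series of `X`-`F`-norms, that is, the union of its
terms. -/
def normInfty (G : Type u) [Group G] [Finite G] : Subgroup G :=
  ⨆ i : ℕ, normSeries X F G i

/-- The terminal term of the ascending series of `πF`-norms, where the `πF`-norm of `G` is the
intersection of the normalizers of the subgroups `K^F O_π(G)`. -/
def piNormInfty (π : Set Nat.Primes) (F : GroupClass.{u}) (G : Type u) [Group G] [Finite G] :
    Subgroup G :=
  normInfty (piGroups π) F G

end Norm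

section Hypercentre

variable {G : Type u} [Group G]

/-- `L / K` is a chief factor of `G`. -/
structure IsChiefFactor (K L : Subgroup G) : Prop where
  normal_bot : K.Normal
  normal_top : L.Normal
  lt : K < L
  eq_or_eq : ∀ M : Subgroup G, M.Normal → K ≤ M → M ≤ L → M = K ∨ M = L

/-- The group `L / K`, as a subgroup of `G / K` (used when `K ≤ L`). -/
abbrev factor (K L : Subgroup G) [K.Normal] : Subgroup (G ⧸ K) :=
  L.map (QuotientGroup.mk' K)

instance factor_normal (K L : Subgroup G) [K.Normal] [hL : L.Normal] : (factor K L).Normal :=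
  hL.map _ (QuotientGroup.mk'_surjective K)

/-- The action of `G` on `L / K` by conjugation; its kernel is `C_G(L / K)`. -/
def factorAction (K L : Subgroup G) [K.Normal] [L.Normal] : G →* MulAut (factor K L) :=
  MulAut.conjNormal.comp (QuotientGroup.mk' K)

instance semidirectProduct_finite {A B : Type u} [Group A] [Group B] [Finite A] [Finite B]
    (φ : B →* MulAut A) : Finite (A ⋊[φ] B) :=
  Finite.of_equiv _ SemidirectProduct.equivProd.symm

variable [Finite G]

/-- `L / K` is `F`-central in `G`: the semidirect product of `L / K` with `G / C_G(L / K)`,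
acting by conjugation, lies in `F`. -/
def IsCentralFactor (F : GroupClass.{u}) (K L : Subgroup G) [K.Normal] [L.Normal] : Prop :=
  F.Mem (factor K L ⋊[QuotientGroup.kerLift (factorAction K L)] (G ⧸ (factorAction K L).ker))

/-- `N` is a `πF`-hypercentral normal subgroup of `G`: all chief factors of `G` below `N` of
order divisible by some prime in `π` are `F`-central in `G`. -/
def IsHypercentral (π : Set Nat.Primes) (F : GroupClass.{u}) (N : Subgroup G) : Prop :=
  N.Normal ∧ ∀ (K L : Subgroup G) [K.Normal] [L.Normal], IsChiefFactor K L → L ≤ N →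
    (∃ p ∈ π, (p : ℕ) ∣ Nat.card (factor K L)) → IsCentralFactor F K L

/-- The `πF`-hypercentre of `G`: the product of all `πF`-hypercentral normal subgroups. -/
def hypercentre (π : Set Nat.Primes) (F : GroupClass.{u}) (G : Type u) [Group G] [Finite G] :
    Subgroup G :=
  sSup {N | IsHypercentral π F N}

end Hypercentre

/-- The intersection of all `X`-maximal subgroups of `G`. -/
def maximalInter (X : GroupClass.{u}) (G : Type u) [Group G] [Finite G] : Subgroup G :=
  sInf {U | Maximal (fun V : Subgroup G => X.Mem V) U}

/-- `G` is `S`-critical for `X`: it is not in `X` but all its proper subgroups are. -/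
def IsCritical (X : GroupClass.{u}) (G : Type u) [Group G] [Finite G] : Prop :=
  ¬ X.Mem G ∧ ∀ H : Subgroup G, H < ⊤ → X.Mem H

/-- The `π`-boundary condition (III): for every `p ∈ π`, each group that is `S`-critical for
`𝔊_p ∘ F` lies in `𝔑_π ∘ F`. -/
def BoundaryConditionIII (π : Set Nat.Primes) (F : GroupClass.{u}) : Prop :=
  ∀ p ∈ π, ∀ (G : Type u) [Group G] [Finite G],
    IsCritical ((piGroups {p}).formationProduct F) G → ((piNilpotent π).formationProduct F).Mem G

end GroupClass

/-- `A` has a normal `p`-complement. -/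
def IsPNilpotent (p : ℕ) (A : Type*) [Group A] : Prop :=
  ∃ N : Subgroup A, N.Normal ∧ ¬ p ∣ Nat.card N ∧ ∀ a : A, ∃ k : ℕ, a ^ p ^ k ∈ N

theorem Subgroup.card_mul_relIndex_of_le {A : Type*} [Group A] {H K : Subgroup A} (h : H ≤ K) :
    Nat.card H * H.relIndex K = Nat.card K := by
  rw [← Subgroup.relIndex_bot_left, ← Subgroup.relIndex_bot_left]
  exact Subgroup.relIndex_mul_relIndex _ _ _ bot_le h

theorem Subgroup.card_comap_dvd {A B : Type*} [Group A] [Group B] [Finite A] [Finite B]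
    (f : A →* B) (N : Subgroup B) : Nat.card (N.comap f) ∣ Nat.card f.ker * Nat.card N := by
  have h1 : f.ker ≤ N.comap f := by
    rw [← MonoidHom.comap_bot]
    exact Subgroup.comap_mono bot_le
  rw [← Subgroup.card_mul_relIndex_of_le h1]
  refine mul_dvd_mul_left _ ?_
  rw [Subgroup.relIndex_ker]
  exact Subgroup.card_dvd_of_le (Subgroup.map_comap_le f N)

namespace IsPNilpotent

variable {p : ℕ} {A B : Type*} [Group A] [Group B]

theorem of_surjective (f : A →* B) (hf : Function.Surjective f) (h : IsPNilpotent p A) :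
    IsPNilpotent p B := by
  obtain ⟨N, hN, h1, h2⟩ := h
  refine ⟨N.map f, hN.map f hf, fun h => h1 (h.trans (Subgroup.card_map_dvd N f)), fun b => ?_⟩
  obtain ⟨a, rfl⟩ := hf b
  obtain ⟨k, hk⟩ := h2 a
  exact ⟨k, by rw [← map_pow]; exact ⟨_, hk, rfl⟩⟩

theorem of_not_dvd_card_ker [Finite A] [Finite B] [hp : Fact p.Prime] (f : A →* B)
    (hf : ¬ p ∣ Nat.card f.ker)
    (h : IsPNilpotent p B) : IsPNilpotent p A := by
  obtain ⟨N, hN, h1, h2⟩ := h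
  refine ⟨N.comap f, hN.comap f, fun h => ?_, fun a => ?_⟩
  · exact (hp.out.dvd_mul.1 (h.trans (Subgroup.card_comap_dvd f N))).elim hf h1
  · obtain ⟨k, hk⟩ := h2 (f a)
    exact ⟨k, by rwa [← map_pow] at hk⟩

theorem of_injective [Finite A] [Finite B] [hp : Fact p.Prime] (f : A →* B) (hf : Function.Injective f)
    (h : IsPNilpotent p B) : IsPNilpotent p A := by
  refine h.of_not_dvd_card_ker f ?_
  rw [(MonoidHom.ker_eq_bot_iff f).2 hf, Subgroup.card_bot]
  exact hp.out.one_lt.ne' ∘ Nat.dvd_one.1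

theorem _root_.IsPGroup.isPNilpotent [hp : Fact p.Prime] (h : IsPGroup p A) :
    IsPNilpotent p A := by
  refine ⟨⊥, inferInstance, ?_, fun a => (h a).imp fun k hk => by simpa using hk⟩
  rw [Subgroup.card_bot]
  exact hp.out.one_lt.ne' ∘ Nat.dvd_one.1

/-- The elements of `p'`-order of a group with a normal `p`-complement lie in the complement. -/
theorem mem_of_pow_mem {N : Subgroup A} {a : A} {n k : ℕ} (hn : n.Coprime p)
    (h1 : a ^ n ∈ N) (h2 : a ^ p ^ k ∈ N) : a ∈ N := by
  have h3 : n.Coprime (p ^ k) := hn.pow_right k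
  have h4 := Nat.gcd_eq_gcd_ab n (p ^ k)
  rw [h3.gcd_eq_one] at h4
  have h5 : a = (a ^ n) ^ (n.gcdA (p ^ k)) * (a ^ p ^ k) ^ (n.gcdB (p ^ k)) := by
    rw [← zpow_natCast, ← zpow_natCast, ← zpow_mul, ← zpow_mul, ← zpow_add, ← h4]
    simp
  rw [h5]
  exact N.mul_mem (N.zpow_mem h1 _) (N.zpow_mem h2 _)

/-- A normal `p`-complement of a subgroup is normalized by the elements that normalize the
subgroup. -/
theorem conj_mem {Y : Type*} [Group Y] [hp : Fact p.Prime] {S : Subgroup Y}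
    {N : Subgroup S} (h1 : ¬ p ∣ Nat.card N) (h2 : ∀ a : S, ∃ k : ℕ, a ^ p ^ k ∈ N) {g n : Y}
    (hg : ∀ s ∈ S, g * s * g⁻¹ ∈ S) (hn : n ∈ N.map S.subtype) :
    g * n * g⁻¹ ∈ N.map S.subtype := by
  obtain ⟨c, hc, rfl⟩ := hn
  have hm : g * S.subtype c * g⁻¹ ∈ S := hg _ c.2
  refine ⟨⟨_, hm⟩, ?_, rfl⟩
  obtain ⟨k, hk⟩ := h2 ⟨_, hm⟩
  refine mem_of_pow_mem ((Nat.Prime.coprime_iff_not_dvd hp.out).2 h1).symm ?_ hk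
  have : (⟨c, hc⟩ : N) ^ Nat.card N = 1 := pow_card_eq_one'
  have h5 : (c : Y) ^ Nat.card N = 1 := congrArg (fun x : N => ((x : S) : Y)) this
  have : (⟨_, hm⟩ : S) ^ Nat.card N = 1 := Subtype.ext (by simp [conj_pow, h5])
  rw [this]
  exact N.one_mem

end IsPNilpotent

/-- A central `p`-subgroup of `p'`-index has a normal complement. -/
theorem Subgroup.exists_normal_complement_of_le_center {A : Type*} [Group A] [Finite A]
    {Z : Subgroup A} (hZ : Z ≤ Subgroup.center A) (h : (Nat.card Z).Coprime Z.index) :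
    ∃ B : Subgroup A, B.Normal ∧ B.IsComplement' Z := by
  have hZn : Z.Normal := ⟨fun n hn g => by
    rw [(Subgroup.mem_center_iff.1 (hZ hn)) g, mul_inv_cancel_right]; exact hn⟩
  obtain ⟨B, hB⟩ := Subgroup.exists_left_complement'_of_coprime h
  refine ⟨B, ⟨fun b hb g => ?_⟩, hB⟩
  obtain ⟨⟨⟨x, hx⟩, ⟨z, hz⟩⟩, hxz⟩ := hB.2 g
  simp only at hxz
  have hzb := Subgroup.mem_center_iff.1 (hZ hz)
  have : g * b * g⁻¹ = x * b * x⁻¹ := by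
    rw [← hxz, mul_inv_rev, mul_assoc x z b, ← hzb b]
    group
  rw [this]
  exact B.mul_mem (B.mul_mem hx hb) (B.inv_mem hx)

theorem IsPNilpotent.of_ker_le_center {p : ℕ} [hp : Fact p.Prime] {A B : Type*} [Group A]
    [Group B] [Finite A] [Finite B] (f : A →* B) (hf : f.ker ≤ Subgroup.center A)
    (h : IsPNilpotent p B) : IsPNilpotent p A := by
  obtain ⟨N, hN, h1, h2⟩ := h
  set M := N.comap f with hM
  have hMn : M.Normal := hN.comap f
  -- the Sylow `p`-subgroup of `f.ker` is central in `M` with `p'`-index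
  obtain ⟨P⟩ : Nonempty (Sylow p f.ker) := inferInstance
  set Z : Subgroup A := P.1.map f.ker.subtype with hZ
  have hZker : Z ≤ f.ker := Subgroup.map_subtype_le _
  have hkM : f.ker ≤ M := by
    rw [← MonoidHom.comap_bot]
    exact Subgroup.comap_mono bot_le
  have hZp : IsPGroup p Z := P.2.map _
  have hidx : ¬ p ∣ Z.relIndex M := by
    have h3 : Z.relIndex f.ker * f.ker.relIndex M = Z.relIndex M :=
      Subgroup.relIndex_mul_relIndex Z f.ker M hZker hkM
    rw [← h3, hp.out.dvd_mul, not_or]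
    constructor
    · have : Z.relIndex f.ker = P.1.index := by
        rw [Subgroup.relIndex, hZ, Subgroup.subgroupOf,
          Subgroup.comap_map_eq_self_of_injective f.ker.subtype_injective]
      rw [this]
      exact P.not_dvd_index
    · rw [Subgroup.relIndex_ker]
      exact fun h => h1 (h.trans (Subgroup.card_dvd_of_le (Subgroup.map_comap_le f N)))
  have hcop : (Nat.card (Z.subgroupOf M)).Coprime (Z.subgroupOf M).index := by
    obtain ⟨n, hn⟩ := IsPGroup.iff_card.1 hZp
    have : Nat.card (Z.subgroupOf M) = p ^ n := by
      rw [← hn]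
      exact Nat.card_congr (Subgroup.subgroupOfEquivOfLe (hZker.trans hkM)).toEquiv
    rw [this]
    exact Nat.Coprime.pow_left _ ((Nat.Prime.coprime_iff_not_dvd hp.out).2 hidx)
  have hcen : Z.subgroupOf M ≤ Subgroup.center M := by
    intro x hx
    rw [Subgroup.mem_center_iff]
    intro g
    exact Subtype.ext (Subgroup.mem_center_iff.1 (hf (hZker hx)) g)
  obtain ⟨C, hC, hcomp⟩ := Subgroup.exists_normal_complement_of_le_center hcen hcop
  have hCcard : Nat.card C = Z.relIndex M := hcomp.index_eq_card.symm
  have hCp : ∀ m : M, ∃ k, m ^ p ^ k ∈ C := by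
    intro m
    obtain ⟨⟨⟨x, hx⟩, ⟨z, hz⟩⟩, hxz⟩ := hcomp.2 m
    simp only at hxz
    obtain ⟨k, hk⟩ := hZp ⟨z, hz⟩
    have hk' : (z : M) ^ p ^ k = 1 := Subtype.ext (by simpa [Subtype.ext_iff] using hk)
    have hcm : Commute x z := Subgroup.mem_center_iff.1 (hcen hz) x
    refine ⟨k, ?_⟩
    rw [← hxz, hcm.mul_pow, hk', mul_one]
    exact C.pow_mem hx _
  have hCd : ¬ p ∣ Nat.card C := hCcard ▸ hidx
  refine ⟨C.map M.subtype, ⟨fun n hn g => ?_⟩, ?_, ?_⟩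
  · exact IsPNilpotent.conj_mem hCd hCp (fun s hs => hMn.conj_mem s hs g) hn
  · rw [Nat.card_congr (C.equivMapOfInjective _ M.subtype_injective).symm.toEquiv]
    exact hCd
  · intro a
    obtain ⟨k, hk⟩ := h2 (f a)
    rw [← map_pow] at hk
    obtain ⟨l, hl⟩ := hCp ⟨_, hk⟩
    exact ⟨k + l, ⟨_, hl, by simp [pow_add, pow_mul]⟩⟩

theorem Group.IsNilpotent.isPNilpotent {p : ℕ} [hp : Fact p.Prime] {A : Type u} [Group A]
    [Finite A] (h : Group.IsNilpotent A) : IsPNilpotent p A := by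
  revert h
  refine fun h => Group.nilpotent_center_quotient_ind
    (P := fun G _ _ => Finite G → IsPNilpotent p G) A ?_ ?_ inferInstance
  · intro G _ _ _
    exact (IsPGroup.of_subsingleton p G).isPNilpotent
  · intro G _ _ ih hG
    exact (ih inferInstance).of_ker_le_center (QuotientGroup.mk' _) (QuotientGroup.ker_mk' _).le

namespace GroupClass

theorem piGroups_singleton_mem_iff (p : Nat.Primes) (G : Type u) [Group G] [Finite G] :
    (piGroups {p}).Mem G ↔ IsPGroup p G := by
  have := Fact.mk p.2
  constructor
  · intro h
    rw [IsPGroup.iff_card]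
    refine ⟨_, Nat.eq_prime_pow_of_unique_prime_dvd Nat.card_pos.ne' fun {d} hd hdG => ?_⟩
    exact congrArg Subtype.val (h ⟨d, hd⟩ hdG)
  · intro h q hq
    obtain ⟨n, hn⟩ := IsPGroup.iff_card.1 h
    rw [hn] at hq
    exact Subtype.ext ((Nat.prime_dvd_prime_iff_eq q.2 p.2).1 (q.2.dvd_of_dvd_pow hq))

theorem piNilpotent_mem_iff (π : Set Nat.Primes) (G : Type u) [Group G] [Finite G] :
    (piNilpotent π).Mem G ↔ ∀ p ∈ π, IsPNilpotent p G := by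
  constructor
  · rintro ⟨N, hN, h1, h2⟩ p hp
    have := Fact.mk p.2
    refine (Group.IsNilpotent.isPNilpotent h2).of_not_dvd_card_ker (QuotientGroup.mk' N) ?_
    rw [QuotientGroup.ker_mk']
    exact fun h => h1 p h hp
  · intro h
    let S : Set (Subgroup G) := {N | ∃ _ : N.Normal, Group.IsNilpotent (G ⧸ N)}
    have hS : S.Nonempty := ⟨⊤, inferInstance, by
      have : Subsingleton (G ⧸ (⊤ : Subgroup G)) := QuotientGroup.subsingleton_quotient_top
      infer_instance⟩
    obtain ⟨N, hNS, hmin⟩ := (Set.toFinite S).exists_minimal hS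
    obtain ⟨hN, hnil⟩ := hNS
    refine ⟨N, hN, ?_, hnil⟩
    intro p hp hpπ
    have := Fact.mk p.2
    obtain ⟨M, hM, h1, h2⟩ := h p hpπ
    have hMS : M ⊓ N ∈ S := by
      refine ⟨inferInstance, ?_⟩
      have hPG : IsPGroup p (G ⧸ M) := by
        intro x
        obtain ⟨g, rfl⟩ := QuotientGroup.mk'_surjective M x
        obtain ⟨k, hk⟩ := h2 g
        exact ⟨k, by rw [← map_pow]; exact (QuotientGroup.eq_one_iff _).2 hk⟩
      have := hPG.isNilpotent
      let f : G →* (G ⧸ M) × (G ⧸ N) := (QuotientGroup.mk' M).prod (QuotientGroup.mk' N)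
      have hk : M ⊓ N = f.ker := by
        rw [MonoidHom.ker_prod, QuotientGroup.ker_mk', QuotientGroup.ker_mk']
      have := Subgroup.isNilpotent_of_ker_le_center (QuotientGroup.kerLift f)
        (by rw [(MonoidHom.ker_eq_bot_iff _).2 (QuotientGroup.kerLift_injective f)]; exact bot_le)
      exact Group.nilpotent_of_mulEquiv (QuotientGroup.quotientMulEquivOfEq hk).symm
    have hle : N ≤ M := (hmin hMS inf_le_right).trans inf_le_left
    exact h1 (hp.trans (Subgroup.card_dvd_of_le hle))

theorem piGroups_mem_sup {π : Set Nat.Primes} {G : Type u} [Group G] [Finite G]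
    {H K : Subgroup G} (hK : K.Normal) (h1 : (piGroups π).Mem H) (h2 : (piGroups π).Mem K) :
    (piGroups π).Mem (H ⊔ K : Subgroup G) := by
  intro p hp
  rw [← Subgroup.card_mul_relIndex_of_le (le_sup_right : K ≤ H ⊔ K), Subgroup.relIndex_sup_right,
    p.2.dvd_mul] at hp
  exact hp.elim (h2 p) fun h => h1 p (h.trans (Subgroup.relIndex_dvd_card K H))

instance radical_normal (X : GroupClass.{u}) (G : Type u) [Group G] [Finite G] :
    (X.radical G).Normal := by
  refine ⟨fun n hn g => ?_⟩
  have h := X.radical_map (MulAut.conj g)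
  rw [← h]
  exact ⟨n, hn, rfl⟩

theorem piGroups_radical_mem (π : Set Nat.Primes) (G : Type u) [Group G] [Finite G] :
    (piGroups π).Mem ((piGroups π).radical G) := by
  let S : Set (Subgroup G) := {N | N.Normal ∧ (piGroups π).Mem N}
  have hS : S.Nonempty := ⟨⊥, inferInstance, fun p hp => by
    rw [Subgroup.card_bot] at hp
    exact absurd (Nat.dvd_one.1 hp) p.2.one_lt.ne'⟩
  obtain ⟨N, hNS, hmax⟩ := (Set.toFinite S).exists_maximal hS
  have : (piGroups π).radical G = N := by
    refine le_antisymm (sSup_le fun M hM => ?_) (le_sSup hNS)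
    have := hNS.1
    have := hM.1
    exact le_sup_left.trans (hmax (y := M ⊔ N)
      ⟨inferInstance, piGroups_mem_sup hNS.1 hM.2 hNS.2⟩ le_sup_right)
  rw [this]
  exact hNS.2

end GroupClass

namespace GroupClass

variable {F : GroupClass.{u}}

theorem IsFormation.mem_of_subsingleton (hF : F.IsFormation) (G : Type u) [Group G] [Finite G]
    [Subsingleton G] : F.Mem G := by
  obtain ⟨H, _, _, hH⟩ := hF.nonempty
  exact hF.image (1 : H →* G) (fun x => ⟨1, Subsingleton.elim _ _⟩) hH

instance residual_normal (F : GroupClass.{u}) (G : Type u) [Group G] [Finite G] :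
    (F.residual G).Normal := by
  refine ⟨fun n hn g => ?_⟩
  rw [← F.residual_map (MulAut.conj g)]
  exact ⟨n, hn, rfl⟩

theorem IsFormation.mem_quotient_residual (hF : F.IsFormation) (G : Type u) [Group G]
    [Finite G] : F.Mem (G ⧸ F.residual G) := by
  let S : Set (Subgroup G) := {N | ∃ _ : N.Normal, F.Mem (G ⧸ N)}
  have hS : S.Nonempty := ⟨⊤, inferInstance, by
    have : Subsingleton (G ⧸ (⊤ : Subgroup G)) := QuotientGroup.subsingleton_quotient_top
    exact hF.mem_of_subsingleton _⟩
  obtain ⟨N, ⟨hN, hNF⟩, hmin⟩ := (Set.toFinite S).exists_minimal hS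
  have hN' : N = F.residual G := by
    refine le_antisymm (le_sInf ?_) (sInf_le ⟨hN, hNF⟩)
    rintro M ⟨hM, hMF⟩
    refine (hmin (y := M ⊓ N) ⟨inferInstance, ?_⟩ inf_le_right).trans inf_le_left
    refine hF.subdirect (QuotientGroup.map (M ⊓ N) M (MonoidHom.id G) inf_le_left)
      (QuotientGroup.map (M ⊓ N) N (MonoidHom.id G) inf_le_right) ?_ ?_ ?_ hMF hNF
    · intro x
      obtain ⟨g, rfl⟩ := QuotientGroup.mk'_surjective M x
      exact ⟨QuotientGroup.mk g, rfl⟩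
    · intro x
      obtain ⟨g, rfl⟩ := QuotientGroup.mk'_surjective N x
      exact ⟨QuotientGroup.mk g, rfl⟩
    · rw [eq_bot_iff]
      intro x hx
      obtain ⟨g, rfl⟩ := QuotientGroup.mk'_surjective _ x
      exact (QuotientGroup.eq_one_iff _).2
        ⟨(QuotientGroup.eq_one_iff _).1 hx.1, (QuotientGroup.eq_one_iff _).1 hx.2⟩
  exact F.mem_of_mulEquiv (QuotientGroup.quotientMulEquivOfEq hN') hNF

theorem IsSubgroupClosed.residual_le_ker (hS : F.IsSubgroupClosed) {G H : Type u}
    [Group G] [Finite G] [Group H] [Finite H] (f : G →* H) (h : F.Mem H) :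
    F.residual G ≤ f.ker :=
  sInf_le ⟨inferInstance, F.mem_of_mulEquiv (QuotientGroup.quotientKerEquivRange f).symm
    (hS H f.range h)⟩

theorem IsFormation.mem_of_residual_le_ker (hF : F.IsFormation) {G H : Type u}
    [Group G] [Finite G] [Group H] [Finite H] (f : G →* H) (hf : Function.Surjective f)
    (h : F.residual G ≤ f.ker) : F.Mem H :=
  hF.image (QuotientGroup.lift (F.residual G) f h)
    (QuotientGroup.lift_surjective_of_surjective _ _ hf _) (hF.mem_quotient_residual G)

theorem IsFormation.map_residual (hF : F.IsFormation) (hS : F.IsSubgroupClosed) {G H : Type u}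
    [Group G] [Finite G] [Group H] [Finite H] (f : G →* H) (hf : Function.Surjective f) :
    (F.residual G).map f = F.residual H := by
  apply le_antisymm
  · rw [Subgroup.map_le_iff_le_comap]
    have := hS.residual_le_ker ((QuotientGroup.mk' (F.residual H)).comp f)
      (hF.mem_quotient_residual H)
    rwa [← MonoidHom.comap_ker, QuotientGroup.ker_mk'] at this
  · have hn : ((F.residual G).map f).Normal := Subgroup.Normal.map inferInstance f hf
    refine sInf_le ⟨hn, hF.mem_of_residual_le_ker
      ((QuotientGroup.mk' ((F.residual G).map f)).comp f)
      ((QuotientGroup.mk'_surjective _).comp hf) ?_⟩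
    rw [← MonoidHom.comap_ker, QuotientGroup.ker_mk']
    exact Subgroup.le_comap_map f _

variable {G H : Type u} [Group G] [Finite G] [Group H] [Finite H]

theorem IsFormation.subgroupResidual_map_hom (hF : F.IsFormation) (hS : F.IsSubgroupClosed)
    (f : G →* H) (K : Subgroup G) :
    F.subgroupResidual (K.map f) = (F.subgroupResidual K).map f := by
  rw [subgroupResidual, subgroupResidual,
    ← hF.map_residual hS (f.subgroupMap K) (f.subgroupMap_surjective K),
    Subgroup.map_map, Subgroup.map_map]
  rfl

theorem subgroupResidual_le (F : GroupClass.{u}) (K : Subgroup G) : F.subgroupResidual K ≤ K :=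
  Subgroup.map_subtype_le _

theorem subgroupResidual_top (F : GroupClass.{u}) (G : Type u) [Group G] [Finite G] :
    F.subgroupResidual (⊤ : Subgroup G) = F.residual G := by
  have := F.residual_map (Subgroup.topEquiv : (⊤ : Subgroup G) ≃* G)
  rw [← this]
  rfl

theorem IsFormation.residual_map_le (hF : F.IsFormation) (hS : F.IsSubgroupClosed)
    (f : G →* H) : (F.residual G).map f ≤ F.residual H := by
  rw [Subgroup.map_le_iff_le_comap]
  have := hS.residual_le_ker ((QuotientGroup.mk' (F.residual H)).comp f)
    (hF.mem_quotient_residual H)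
  rwa [← MonoidHom.comap_ker, QuotientGroup.ker_mk'] at this

theorem IsFormation.subgroupResidual_mono (hF : F.IsFormation) (hS : F.IsSubgroupClosed)
    {K L : Subgroup G} (h : K ≤ L) : F.subgroupResidual K ≤ F.subgroupResidual L := by
  have := hF.residual_map_le hS (Subgroup.inclusion h)
  have h2 := Subgroup.map_mono (f := L.subtype) this
  rwa [Subgroup.map_map] at h2

theorem IsFormation.subgroupResidual_le_residual (hF : F.IsFormation) (hS : F.IsSubgroupClosed)
    (K : Subgroup G) : F.subgroupResidual K ≤ F.residual G := by
  rw [← subgroupResidual_top]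
  exact hF.subgroupResidual_mono hS le_top

theorem le_normalizer_subgroupResidual (F : GroupClass.{u}) (K : Subgroup G) :
    K ≤ Subgroup.normalizer (F.subgroupResidual K : Set G) := by
  have : ((F.subgroupResidual K).subgroupOf K).Normal := by
    rw [subgroupResidual, Subgroup.subgroupOf,
      Subgroup.comap_map_eq_self_of_injective K.subtype_injective]
    infer_instance
  exact Subgroup.normal_subgroupOf_iff_le_normalizer (F.subgroupResidual_le K) |>.1 this

theorem residual_equiv_subgroupResidual (F : GroupClass.{u}) (K : Subgroup G) :
    Nonempty (F.residual K ≃* F.subgroupResidual K) :=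
  ⟨(F.residual K).equivMapOfInjective K.subtype K.subtype_injective⟩

theorem piNilpotent_formationProduct_mem_iff (π : Set Nat.Primes) (F : GroupClass.{u})
    (K : Subgroup G) : ((piNilpotent π).formationProduct F).Mem K ↔
      ∀ p ∈ π, IsPNilpotent p (F.subgroupResidual K) := by
  obtain ⟨e⟩ := F.residual_equiv_subgroupResidual K
  refine (piNilpotent_mem_iff π _).trans (forall₂_congr fun p _ => ?_)
  exact ⟨fun h => h.of_surjective e.toMonoidHom e.surjective,
    fun h => h.of_surjective e.symm.toMonoidHom e.symm.surjective⟩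

theorem piGroups_formationProduct_mem_iff (p : Nat.Primes) (F : GroupClass.{u})
    (K : Subgroup G) : ((piGroups {p}).formationProduct F).Mem K ↔
      IsPGroup p (F.subgroupResidual K) := by
  obtain ⟨e⟩ := F.residual_equiv_subgroupResidual K
  refine (piGroups_singleton_mem_iff p _).trans ?_
  exact ⟨fun h => h.of_equiv e, fun h => h.of_equiv e.symm⟩

/-- The class `𝔑_π ∘ F` is closed under homomorphic images. -/
theorem IsFormation.piNilpotent_formationProduct_image (hF : F.IsFormation)
    (hS : F.IsSubgroupClosed) {π : Set Nat.Primes} (f : G →* H) {K : Subgroup G}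
    (h : ((piNilpotent π).formationProduct F).Mem K) :
    ((piNilpotent π).formationProduct F).Mem (K.map f) := by
  rw [piNilpotent_formationProduct_mem_iff] at h ⊢
  intro p hp
  rw [hF.subgroupResidual_map_hom hS]
  exact (h p hp).of_surjective (f.subgroupMap _) (f.subgroupMap_surjective _)

end GroupClass

namespace Subgroup

open MulAction MulOpposite
open scoped Pointwise

theorem IsComplement'.eq_stabilizer {A : Type*} [Group A] [Finite A] {E B : Subgroup A}
    [E.Normal] [IsMulCommutative E] (hE : (Nat.card E).Coprime E.index)
    (hB : IsComplement' B E) : ∃ α : E.QuotientDiff, B = stabilizer A α := by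
  let T : E.LeftTransversal := ⟨(B : Set A), hB⟩
  let α : E.QuotientDiff := Quotient.mk'' T
  have hα : IsComplement' E (stabilizer A α) := isComplement'_stabilizer_of_coprime hE
  have hle : B ≤ stabilizer A α := by
    intro b hb
    rw [mem_stabilizer_iff]
    have : op b⁻¹ • T = T := by
      apply Subtype.ext
      ext x
      change x ∈ op b⁻¹ • (B : Set A) ↔ x ∈ B
      rw [Set.mem_smul_set_iff_inv_smul_mem]
      simp [B.mul_mem_cancel_right hb]
    exact congrArg Quotient.mk'' this
  refine ⟨α, Subgroup.eq_of_le_of_card_ge hle ?_⟩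
  rw [← hB.index_eq_card, ← hα.symm.index_eq_card]

/-- The complements of an abelian normal Hall subgroup are conjugate. -/
theorem IsComplement'.exists_conj_eq {A : Type*} [Group A] [Finite A] {E B C : Subgroup A}
    [E.Normal] [IsMulCommutative E] (hE : (Nat.card E).Coprime E.index)
    (hB : IsComplement' B E) (hC : IsComplement' C E) :
    ∃ e ∈ E, C = B.map (MulAut.conj e).toMonoidHom := by
  obtain ⟨α, rfl⟩ := hB.eq_stabilizer hE
  obtain ⟨β, rfl⟩ := hC.eq_stabilizer hE
  obtain ⟨e, he⟩ := exists_smul_eq hE α β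
  refine ⟨e, e.2, ?_⟩
  have he' : (e : A) • α = β := he
  rw [← he', stabilizer_smul_eq_stabilizer_map_conj]

variable {p : ℕ} [hp : Fact p.Prime]

/-- An abelian normal `p`-subgroup inside the Frattini subgroup splits off as a direct factor of
every normal subgroup in which it has `p'`-index. -/
theorem exists_normal_of_abelian_le_frattini {H : Type*} [Group H] [Finite H] {E A : Subgroup H}
    [hEn : E.Normal] [hAn : A.Normal] (hEA : E ≤ A) (hEc : IsMulCommutative E)
    (hEp : IsPGroup p E) (hEf : E ≤ frattini H) (hidx : ¬ p ∣ E.relIndex A) :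
    ∃ B : Subgroup H, B.Normal ∧ ¬ p ∣ Nat.card B ∧ A ≤ B ⊔ E := by
  have hcop : (Nat.card (E.subgroupOf A)).Coprime (E.subgroupOf A).index := by
    obtain ⟨n, hn⟩ := IsPGroup.iff_card.1 hEp
    have : Nat.card (E.subgroupOf A) = p ^ n := by
      rw [← hn]
      exact Nat.card_congr (Subgroup.subgroupOfEquivOfLe hEA).toEquiv
    rw [this]
    exact Nat.Coprime.pow_left _ ((Nat.Prime.coprime_iff_not_dvd hp.out).2 hidx)
  have hcomm : IsMulCommutative (E.subgroupOf A) :=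
    ⟨⟨fun x y => Subtype.ext (Subtype.ext (congrArg (Subtype.val : E → H)
      (hEc.is_comm.comm ⟨_, x.2⟩ ⟨_, y.2⟩)))⟩⟩
  obtain ⟨B, hB⟩ := exists_left_complement'_of_coprime hcop
  have hcard : Nat.card B = E.relIndex A := hB.index_eq_card.symm
  have htop : normalizer ((B.map A.subtype : Subgroup H) : Set H) = ⊤ := by
    refine frattini_nongenerating (eq_top_iff.2 fun h _ => ?_)
    let φ : A ≃* A := MulAut.conjNormal h
    have hφB : Nat.card (B.map φ.toMonoidHom) = Nat.card B :=
      Nat.card_congr (φ.subgroupMap B).symm.toEquiv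
    have hC : IsComplement' (B.map φ.toMonoidHom) (E.subgroupOf A) := by
      refine isComplement'_of_coprime ?_ ?_
      · exact (congrArg (· * _) hφB).trans hB.card_mul_card
      · rw [hφB, ← hB.index_eq_card]
        exact hcop.symm
    obtain ⟨e, he, heq⟩ := hB.exists_conj_eq hcop hC
    have he' : (e : H) ∈ E := he
    have hmem : (e : H)⁻¹ * h ∈ normalizer ((B.map A.subtype : Subgroup H) : Set H) := by
      refine mem_normalizer_fintype ?_
      rintro _ ⟨b, hb, rfl⟩
      have hb' : φ b ∈ B.map φ.toMonoidHom := ⟨b, hb, rfl⟩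
      rw [heq] at hb'
      obtain ⟨c, hc, hcb⟩ := hb'
      refine ⟨c, hc, ?_⟩
      have hcb' : (e : H) * c * (e : H)⁻¹ = h * b * h⁻¹ := congrArg Subtype.val hcb
      have : (c : H) = (e : H)⁻¹ * (h * b * h⁻¹) * e := by rw [← hcb']; group
      simp only [subtype_apply, this]
      group
    have : h = (e : H) * ((e : H)⁻¹ * h) := by group
    rw [this]
    exact mul_mem (mem_sup_right (hEf he')) (mem_sup_left hmem)
  refine ⟨B.map A.subtype, normalizer_eq_top_iff.1 htop, ?_, ?_⟩
  · rw [Nat.card_congr (B.equivMapOfInjective _ A.subtype_injective).symm.toEquiv, hcard]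
    exact hidx
  · intro a ha
    obtain ⟨⟨⟨x, hx⟩, ⟨z, hz⟩⟩, hxz⟩ := hB.2 ⟨a, ha⟩
    have : a = (x : H) * z := congrArg Subtype.val hxz.symm
    rw [this]
    exact mul_mem (mem_sup_left ⟨x, hx, rfl⟩) (mem_sup_right hz)

end Subgroup

open scoped commutatorElement in
/-- A normal subgroup of `H` that is `p`-nilpotent modulo a subgroup of the Frattini subgroup of
`H` is `p`-nilpotent. -/
theorem IsPNilpotent.of_ker_le_frattini {p : ℕ} [hp : Fact p.Prime] {H Y : Type*} [Group H]
    [Finite H] [Group Y] [Finite Y] (f : H →* Y) (hf : f.ker ≤ frattini H) (R : Subgroup H)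
    [hR : R.Normal] (h : IsPNilpotent p (R.map f)) : IsPNilpotent p R := by
  obtain ⟨N, hN, h1, h2⟩ := h
  let S : Set (Subgroup H) := {M | M.Normal ∧ M ≤ frattini H ∧ IsPGroup p M ∧
    ∃ A : Subgroup H, A.Normal ∧ M ≤ A ∧ ¬ p ∣ M.relIndex A ∧ ∀ r ∈ R, ∃ k : ℕ, r ^ p ^ k ∈ A}
  have hS : S.Nonempty := by
    let A : Subgroup H := (N.map (R.map f).subtype).comap f
    have hA : A.Normal := by
      refine ⟨fun a ha g => ?_⟩
      have : f (g * a * g⁻¹) ∈ N.map (R.map f).subtype := by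
        rw [map_mul, map_mul, map_inv]
        refine IsPNilpotent.conj_mem h1 h2 ?_ ha
        rintro _ ⟨r, hr, rfl⟩
        exact ⟨g * r * g⁻¹, hR.conj_mem r hr g, by simp⟩
      exact this
    have hDA : f.ker ≤ A := by
      rw [← MonoidHom.comap_bot]
      exact Subgroup.comap_mono bot_le
    obtain ⟨P⟩ : Nonempty (Sylow p f.ker) := inferInstance
    have hPD : P.1.map f.ker.subtype ≤ f.ker := Subgroup.map_subtype_le _
    refine ⟨P.1.map f.ker.subtype, ?_, hPD.trans hf, P.2.map _, A, hA, hPD.trans hDA, ?_, ?_⟩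
    · rw [← Subgroup.normalizer_eq_top_iff]
      refine frattini_nongenerating (eq_top_iff.2 ?_)
      rw [← P.normalizer_sup_eq_top]
      exact sup_le_sup_left hf _
    · rw [← Subgroup.relIndex_mul_relIndex _ f.ker A hPD hDA, hp.out.dvd_mul, not_or]
      constructor
      · rw [Subgroup.relIndex, Subgroup.subgroupOf,
          Subgroup.comap_map_eq_self_of_injective f.ker.subtype_injective]
        exact P.not_dvd_index
      · rw [Subgroup.relIndex_ker]
        intro hd
        refine h1 (hd.trans ((Subgroup.card_dvd_of_le (Subgroup.map_comap_le f _)).trans ?_))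
        exact Subgroup.card_map_dvd N _
    · intro r hr
      obtain ⟨k, hk⟩ := h2 ⟨f r, r, hr, rfl⟩
      exact ⟨k, ⟨_, hk, by simp⟩⟩
  obtain ⟨M, ⟨hM, hMf, hMp, A, hA, hMA, hidx, hpow⟩, hmin⟩ := (Set.toFinite S).exists_minimal hS
  have hbot : M = ⊥ := by
    by_contra hne
    have : Nontrivial M := (Subgroup.nontrivial_iff_ne_bot M).2 hne
    let M' : Subgroup H := ⁅M, M⁆
    have hM'M : M' ≤ M := Subgroup.commutator_le_left M M
    have hlt : ¬ M ≤ M' := by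
      intro hle
      have := hMp.isNilpotent
      have h3 := Group.IsSolvable.commutator_lt_top_of_nontrivial M
      rw [← Subgroup.map_subtype_lt_map_subtype, commutator_def, Subgroup.map_commutator,
        ← MonoidHom.range_eq_map,
        M.range_subtype] at h3
      exact absurd hle h3.not_ge
    let q := QuotientGroup.mk' M'
    have hq : Function.Surjective q := QuotientGroup.mk'_surjective M'
    have hqk : q.ker = M' := QuotientGroup.ker_mk' M'
    have hEn : (M.map q).Normal := hM.map q hq
    have hAn : (A.map q).Normal := hA.map q hq
    have hEc : IsMulCommutative (M.map q) := by
      refine ⟨⟨?_⟩⟩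
      rintro ⟨_, a, ha, rfl⟩ ⟨_, b, hb, rfl⟩
      refine Subtype.ext ?_
      change q a * q b = q b * q a
      rw [← map_mul, ← map_mul]
      refine QuotientGroup.eq.2 ?_
      have : (a * b)⁻¹ * (b * a) = ⁅b⁻¹, a⁻¹⁆ := by
        rw [commutatorElement_def]; group
      rw [this]
      exact Subgroup.commutator_mem_commutator (M.inv_mem hb) (M.inv_mem ha)
    obtain ⟨B, hB, hBp, hAB⟩ := Subgroup.exists_normal_of_abelian_le_frattini (p := p)
      (Subgroup.map_mono (f := q) hMA) hEc (hMp.map q)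
      ((Subgroup.map_mono hMf).trans (Subgroup.map_le_iff_le_comap.2
        (frattini_le_comap_frattini_of_surjective hq))) (by
        rwa [← Subgroup.relIndex_comap, Subgroup.comap_map_eq_self (hqk.trans_le hM'M)])
    refine hlt (hmin (y := M') ⟨inferInstance, hM'M.trans hMf, hMp.to_le hM'M, B.comap q,
      hB.comap q, ?_, ?_, ?_⟩ hM'M)
    · rw [← MonoidHom.comap_bot] at hqk
      exact hqk.ge.trans (Subgroup.comap_mono bot_le)
    · have h3 := Subgroup.relIndex_ker (B.comap q) q
      rw [hqk, Subgroup.map_comap_eq_self_of_surjective hq] at h3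
      rw [h3]
      exact hBp
    · intro r hr
      obtain ⟨k, hk⟩ := hpow r hr
      have h3 := hAB ⟨_, hk, rfl⟩
      obtain ⟨b, hb, e, he, hbe⟩ := (Subgroup.mem_sup_of_normal_left).1 h3
      obtain ⟨j, hj⟩ := (hMp.map q) ⟨e, he⟩
      refine ⟨k + j, ?_⟩
      rw [pow_add, pow_mul, Subgroup.mem_comap, map_pow, ← hbe]
      have hj' : e ^ p ^ j = 1 := by simpa [Subtype.ext_iff] using hj
      have h5 : QuotientGroup.mk' B ((b * e) ^ p ^ j) = 1 := by
        rw [map_pow, map_mul, show QuotientGroup.mk' B b = 1 from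
          (QuotientGroup.eq_one_iff b).2 hb, one_mul, ← map_pow, hj', map_one]
      exact (QuotientGroup.eq_one_iff _).1 h5
  subst hbot
  rw [Subgroup.relIndex_bot_left] at hidx
  refine ⟨A.subgroupOf R, inferInstance, fun hd => hidx (hd.trans ?_), fun a => ?_⟩
  · exact Subgroup.card_comap_dvd_of_injective A R.subtype R.subtype_injective
  · exact hpow a a.2

/-- The group `V` has no proper non-trivial subgroup that is invariant under the action `ρ`. -/
def ActsIrreducibly {G V : Type*} [Group G] [Group V] (ρ : G →* MulAut V) : Prop :=
  ∀ B : Subgroup V, (∀ g, ∀ b ∈ B, ρ g b ∈ B) → B = ⊥ ∨ B = ⊤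

namespace ActsIrreducibly

variable {G V : Type u} [Group G] [Group V] [Finite V] {ρ : G →* MulAut V}

theorem eq_bot_of_normal (h : ActsIrreducibly ρ) (p : Nat.Primes) (hp : (p : ℕ) ∣ Nat.card V) {B : Subgroup V}
    (hB : B.Normal) (hBp : ¬ (p : ℕ) ∣ Nat.card B) : B = ⊥ := by
  let X := GroupClass.piGroups.{u} {p}ᶜ
  have hBX : B ≤ X.radical V := le_sSup ⟨hB, fun q hq hqp => hBp (by
    rw [Set.mem_singleton_iff] at hqp
    rwa [← hqp])⟩
  have hO := h (X.radical V) fun g b hb => by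
    rw [← X.radical_map (ρ g)]
    exact ⟨b, hb, rfl⟩
  rcases hO with hO | hO
  · exact eq_bot_iff.2 (hBX.trans hO.le)
  · have := GroupClass.piGroups_radical_mem {p}ᶜ V p
    change _ ∣ Nat.card (X.radical V) → _ at this
    rw [hO, Subgroup.card_top] at this
    exact absurd rfl (this hp)

/-- A normal subgroup that induces a `p`-group of automorphisms on an irreducible group of order
divisible by `p` acts trivially. -/
theorem le_ker_of_isPGroup (h : ActsIrreducibly ρ) {p : ℕ} [Fact p.Prime] (hp : p ∣ Nat.card V)
    {N : Subgroup G} (hN : N.Normal) (hNp : IsPGroup p (N.map ρ)) : N ≤ ρ.ker := by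
  let B : Subgroup V :=
    { carrier := {v | ∀ n ∈ N, ρ n v = v}
      mul_mem' := fun ha hb n hn => by rw [map_mul, ha n hn, hb n hn]
      one_mem' := fun n _ => map_one _
      inv_mem' := fun ha n hn => by rw [map_inv, ha n hn] }
  have hBi := h B fun g b hb n hn => by
    have h1 := hb (g⁻¹ * n * g) (by simpa using hN.conj_mem n hn g⁻¹)
    have h2 : ρ n (ρ g b) = ρ g (ρ (g⁻¹ * n * g) b) := by
      rw [← MulAut.mul_apply, ← MulAut.mul_apply, ← map_mul, ← map_mul]
      congr 2
      group
    rw [h2, h1]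
  have hne : B ≠ ⊥ := by
    obtain ⟨b, hb, hb1⟩ := hNp.exists_fixed_point_of_prime_dvd_card_of_fixed_point V hp
      (a := 1) (fun x => map_one (x : MulAut V))
    intro hbot
    have hbB : b ∈ B := fun n hn => hb ⟨ρ n, n, hn, rfl⟩
    rw [hbot, Subgroup.mem_bot] at hbB
    exact hb1 hbB.symm
  have htop := hBi.resolve_left hne
  intro n hn
  rw [MonoidHom.mem_ker]
  ext v
  have : v ∈ B := htop ▸ Subgroup.mem_top v
  exact this n hn

end ActsIrreducibly

namespace GroupClass

section Factor

variable {G : Type u} [Group G] {K L : Subgroup G} [K.Normal] [L.Normal]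

theorem factorAction_apply_mk (g : G) {l : G} (hl : QuotientGroup.mk' K l ∈ factor K L) :
    ((factorAction K L g ⟨QuotientGroup.mk' K l, hl⟩ : factor K L) : G ⧸ K) =
      QuotientGroup.mk' K (g * l * g⁻¹) := by
  simp [factorAction, MulAut.conjNormal_apply]

theorem mem_ker_factorAction {g : G} :
    g ∈ (factorAction K L).ker ↔ ∀ l ∈ L, g * l * g⁻¹ * l⁻¹ ∈ K := by
  have key : ∀ l : G, QuotientGroup.mk' K (g * l * g⁻¹) = QuotientGroup.mk' K l ↔
      g * l * g⁻¹ * l⁻¹ ∈ K := fun l => by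
    rw [← mul_inv_eq_one, ← map_inv, ← map_mul, ← MonoidHom.mem_ker, QuotientGroup.ker_mk']
  constructor
  · intro hg l hl
    have hl' : QuotientGroup.mk' K l ∈ factor K L := ⟨l, hl, rfl⟩
    rw [← key, ← factorAction_apply_mk g hl', MonoidHom.mem_ker.1 hg]
    rfl
  · intro hg
    rw [MonoidHom.mem_ker]
    ext ⟨_, l, hl, rfl⟩
    exact (factorAction_apply_mk g _).trans ((key l).2 (hg l hl))

theorem IsChiefFactor.actsIrreducibly (h : IsChiefFactor K L) :
    ActsIrreducibly (factorAction K L) := by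
  intro B hB
  let q := QuotientGroup.mk' K
  have hq : Function.Surjective q := QuotientGroup.mk'_surjective K
  have hqk : q.ker = K := QuotientGroup.ker_mk' K
  let M : Subgroup G := (B.map (factor K L).subtype).comap q
  have hBM : B = (M.map q).comap (factor K L).subtype := by
    rw [Subgroup.map_comap_eq_self_of_surjective hq,
      Subgroup.comap_map_eq_self_of_injective (factor K L).subtype_injective]
  have hM : M.Normal := by
    refine ⟨?_⟩
    rintro m ⟨⟨b, hb'⟩, hb, hbm : b = q m⟩ g
    subst hbm
    exact ⟨_, hB g _ hb, factorAction_apply_mk g hb'⟩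
  have hKM : K ≤ M := by
    rw [← hqk, ← MonoidHom.comap_bot]
    exact Subgroup.comap_mono bot_le
  have hML : M ≤ L := by
    have h1 : M ≤ (factor K L).comap q := Subgroup.comap_mono (Subgroup.map_subtype_le _)
    rwa [Subgroup.comap_map_eq_self (hqk.trans_le h.lt.le)] at h1
  rcases h.eq_or_eq M hM hKM hML with h1 | h1
  · left
    rw [hBM, h1, show K.map q = ⊥ from by rw [Subgroup.map_eq_bot_iff, hqk]]
    exact (MonoidHom.ker_eq_bot_iff _).2 (factor K L).subtype_injective
  · right
    rw [hBM, h1]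
    exact Subgroup.subgroupOf_self _

variable [Finite G]

/-- A `p`-nilpotent subgroup normalized by `L` induces a `p`-group on the chief factor `L / K`
of order divisible by `p`. -/
theorem IsChiefFactor.isPGroup_map (h : IsChiefFactor K L) (p : Nat.Primes)
    (hp : (p : ℕ) ∣ Nat.card (factor K L)) {A : Subgroup G} (hA : IsPNilpotent p A)
    (hLA : L ≤ Subgroup.normalizer (A : Set G)) : IsPGroup p (A.map (factorAction K L)) := by
  have := Fact.mk p.2
  obtain ⟨N, hN, h1, h2⟩ := hA
  let Q : Subgroup G := N.map A.subtype
  have hQL : ∀ l ∈ L, ∀ x ∈ Q, l * x * l⁻¹ ∈ Q := fun l hl x hx =>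
    IsPNilpotent.conj_mem h1 h2 (fun s hs => (Subgroup.mem_normalizer_iff.1 (hLA hl) s).1 hs) hx
  let B : Subgroup (factor K L) := ((Q ⊓ L).map (QuotientGroup.mk' K)).subgroupOf (factor K L)
  have hB : B.Normal := by
    refine ⟨?_⟩
    rintro ⟨b, hb'⟩ ⟨x, ⟨hxQ, hxL⟩, hxb : _ = b⟩ ⟨_, l, hl, rfl⟩
    subst hxb
    exact ⟨l * x * l⁻¹, ⟨hQL l hl x hxQ, L.mul_mem (L.mul_mem hl hxL) (L.inv_mem hl)⟩, by simp⟩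
  have hBp : ¬ (p : ℕ) ∣ Nat.card B := by
    intro hd
    refine h1 (hd.trans ((Subgroup.card_comap_dvd_of_injective _ _
      (factor K L).subtype_injective).trans ((Subgroup.card_map_dvd _ _).trans
        ((Subgroup.card_dvd_of_le inf_le_left).trans (Subgroup.card_map_dvd _ _)))))
  have hbot := h.actsIrreducibly.eq_bot_of_normal p hp hB hBp
  have hQK : ∀ x ∈ Q, x ∈ L → x ∈ K := by
    intro x hxQ hxL
    have : (⟨QuotientGroup.mk' K x, x, hxL, rfl⟩ : factor K L) ∈ B := ⟨x, ⟨hxQ, hxL⟩, rfl⟩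
    rw [hbot, Subgroup.mem_bot] at this
    exact (QuotientGroup.eq_one_iff x).1 (congrArg Subtype.val this)
  have hQker : Q ≤ (factorAction K L).ker := by
    intro x hx
    rw [mem_ker_factorAction]
    intro l hl
    refine hQK _ ?_ (L.mul_mem (h.normal_top.conj_mem l hl x) (L.inv_mem hl))
    rw [mul_assoc, mul_assoc, ← mul_assoc l]
    exact Q.mul_mem hx (hQL l hl _ (Q.inv_mem hx))
  rintro ⟨_, a, ha, rfl⟩
  obtain ⟨k, hk⟩ := h2 ⟨a, ha⟩
  refine ⟨k, Subtype.ext ?_⟩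
  have : a ^ (p : ℕ) ^ k ∈ Q := ⟨_, hk, by simp⟩
  simpa using hQker this

end Factor

variable {F : GroupClass.{u}} {π : Set Nat.Primes}

/-- The class `𝔑_π ∘ F` is saturated. -/
theorem piNilpotent_formationProduct_mem_of_frattini (hF : F.IsFormation)
    (hS : F.IsSubgroupClosed) {H Y : Type u} [Group H] [Finite H] [Group Y] [Finite Y]
    (f : H →* Y) (hf : f.ker ≤ frattini H)
    (h : ((piNilpotent π).formationProduct F).Mem f.range) :
    ((piNilpotent π).formationProduct F).Mem H := by
  refine (piNilpotent_mem_iff π _).2 fun p hp => ?_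
  have := Fact.mk p.2
  refine IsPNilpotent.of_ker_le_frattini f hf _ ?_
  have h1 := (piNilpotent_formationProduct_mem_iff π F f.range).1 h p hp
  rwa [MonoidHom.range_eq_map, hF.subgroupResidual_map_hom hS, subgroupResidual_top] at h1

theorem IsChiefFactor.residual_le_ker {G : Type u} [Group G] [Finite G] {K L : Subgroup G}
    [K.Normal] [L.Normal] (hF : F.IsFormation) (hS : F.IsSubgroupClosed)
    (h3 : BoundaryConditionIII π F) (hc : IsChiefFactor K L) {p : Nat.Primes} (hp : p ∈ π)
    (hd : (p : ℕ) ∣ Nat.card (factor K L))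
    (hA : ∀ T : Subgroup G, ((piNilpotent π).formationProduct F).Mem T →
      ∃ A : Subgroup G, F.subgroupResidual T ≤ A ∧ IsPNilpotent p A ∧
        L ≤ Subgroup.normalizer (A : Set G)) :
    F.residual G ≤ (factorAction K L).ker := by
  have := Fact.mk p.2
  set ρ := factorAction K L with hρ
  refine hc.actsIrreducibly.le_ker_of_isPGroup hd inferInstance ?_
  by_contra hcon
  let S : Set (Subgroup G) := {H | ¬ IsPGroup p ((F.subgroupResidual H).map ρ)}
  have hSne : S.Nonempty := ⟨⊤, by
    change ¬ IsPGroup p _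
    rwa [subgroupResidual_top]⟩
  obtain ⟨H, hHS, hmin⟩ := (Set.toFinite S).exists_minimal hSne
  have hlt : ∀ M : Subgroup G, M < H → IsPGroup p (F.subgroupResidual (M.map ρ)) := by
    intro M hM
    rw [hF.subgroupResidual_map_hom hS]
    by_contra hMS
    exact hM.not_ge (hmin (y := M) hMS hM.le)
  have hHS' : ¬ IsPGroup p (F.subgroupResidual (H.map ρ)) := by
    rwa [hF.subgroupResidual_map_hom hS]
  have hcrit : IsCritical ((piGroups {p}).formationProduct F) (H.map ρ) := by
    refine ⟨fun h => hHS' ((piGroups_formationProduct_mem_iff p F _).1 h), fun T hT => ?_⟩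
    have hTlt : T.map (H.map ρ).subtype < H.map ρ := by
      refine lt_of_le_of_ne (Subgroup.map_subtype_le _) fun heq => hT.ne ?_
      rw [← Subgroup.comap_map_eq_self_of_injective (H.map ρ).subtype_injective T, heq]
      exact Subgroup.subgroupOf_self _
    let M : Subgroup G := H ⊓ (T.map (H.map ρ).subtype).comap ρ
    have hMmap : M.map ρ = T.map (H.map ρ).subtype := by
      apply le_antisymm
      · exact (Subgroup.map_mono inf_le_right).trans (Subgroup.map_comap_le _ _)
      · intro y hy
        obtain ⟨x, hx, rfl⟩ := hTlt.le hy
        exact ⟨x, ⟨hx, hy⟩, rfl⟩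
    have hMH : M < H := by
      refine lt_of_le_of_ne inf_le_left fun heq => hTlt.ne ?_
      rw [← hMmap, heq]
    have h4 := (piGroups_formationProduct_mem_iff p F _).2 (hlt M hMH)
    refine GroupClass.mem_of_mulEquiv _ ?_ h4
    exact (MulEquiv.subgroupCongr hMmap).trans
      (T.equivMapOfInjective _ (H.map ρ).subtype_injective).symm
  have hX := h3 p hp _ hcrit
  let f : H →* MulAut (factor K L) := ρ.comp H.subtype
  have hfr : f.range = H.map ρ := by
    rw [MonoidHom.range_eq_map, ← Subgroup.map_map, ← MonoidHom.range_eq_map,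
      H.range_subtype]
  have hker : f.ker ≤ frattini H := by
    refine le_iInf₂ fun M hM => ?_
    by_contra hle
    have hsup : M ⊔ f.ker = ⊤ := hM.2 _ (lt_of_le_of_ne le_sup_left fun heq =>
      hle (heq ▸ le_sup_right))
    have hMlt : M.map H.subtype < H := by
      refine lt_of_le_of_ne (Subgroup.map_subtype_le _) fun heq => hM.1 ?_
      rw [← Subgroup.comap_map_eq_self_of_injective H.subtype_injective M, heq]
      exact Subgroup.subgroupOf_self _
    have hmap : (M.map H.subtype).map ρ = H.map ρ := by
      rw [← hfr, MonoidHom.range_eq_map, ← hsup, Subgroup.map_sup,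
        (Subgroup.map_eq_bot_iff _).2 le_rfl, sup_bot_eq, Subgroup.map_map]
    exact hHS' (hmap ▸ hlt _ hMlt)
  have hHX : ((piNilpotent π).formationProduct F).Mem H :=
    piNilpotent_formationProduct_mem_of_frattini hF hS f hker (by rwa [hfr])
  obtain ⟨A, hHA, hAp, hLA⟩ := hA H hHX
  exact hHS ((hc.isPGroup_map p hd hAp hLA).to_le (Subgroup.map_mono hHA))

end GroupClass

namespace GroupClass

variable {F : GroupClass.{u}} {π : Set Nat.Primes} {G : Type u} [Group G]

section Factor

variable {K L : Subgroup G} [K.Normal] [L.Normal]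

theorem factorAction_apply_of_mem {l : G} (hl : l ∈ L) :
    factorAction K L l = MulAut.conj ⟨QuotientGroup.mk' K l, l, hl, rfl⟩ := by
  ext ⟨_, x, hx, rfl⟩
  refine (factorAction_apply_mk l _).trans ?_
  simp

/-- The conjugation action of `(L / K) ⋊ (G / C_G(L / K))` on its normal subgroup `L / K`. -/
def factorSemidirectAction (K L : Subgroup G) [K.Normal] [L.Normal] :
    factor K L ⋊[QuotientGroup.kerLift (factorAction K L)] (G ⧸ (factorAction K L).ker) →*
      (factorAction K L).range :=
  SemidirectProduct.lift
    ((MulAut.conj : factor K L →* MulAut (factor K L)).codRestrict _ (by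
      rintro ⟨_, l, hl, rfl⟩
      exact ⟨l, factorAction_apply_of_mem hl⟩))
    (QuotientGroup.rangeKerLift (factorAction K L)) (by
      intro a
      obtain ⟨g, rfl⟩ := QuotientGroup.mk'_surjective _ a
      ext v : 1
      apply Subtype.ext
      ext w
      simp [QuotientGroup.rangeKerLift]
      rfl)

theorem coe_factorSemidirectAction (v : factor K L) (a : G ⧸ (factorAction K L).ker) :
    (factorSemidirectAction K L ⟨v, a⟩ : MulAut (factor K L)) =
      MulAut.conj v * QuotientGroup.kerLift (factorAction K L) a := by
  obtain ⟨g, rfl⟩ := QuotientGroup.mk'_surjective _ a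
  rfl

theorem factorSemidirectAction_surjective :
    Function.Surjective (factorSemidirectAction K L) := by
  rintro ⟨_, g, rfl⟩
  refine ⟨⟨1, QuotientGroup.mk g⟩, Subtype.ext ?_⟩
  rw [coe_factorSemidirectAction, map_one, one_mul]
  rfl

theorem mul_inl_eq_inl_mul
    (x : factor K L ⋊[QuotientGroup.kerLift (factorAction K L)] (G ⧸ (factorAction K L).ker))
    (v : factor K L) : x * SemidirectProduct.inl v =
      SemidirectProduct.inl ((factorSemidirectAction K L x : MulAut (factor K L)) v) * x := by
  obtain ⟨w, a⟩ := x
  rw [coe_factorSemidirectAction]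
  ext <;> simp

end Factor

/-- If a nilpotent normal subgroup `R` of `H` and a normal subgroup `V` meet non-trivially, then
`R` centralizes a non-trivial element of `V`. -/
theorem exists_ne_one_commute_of_isNilpotent {H : Type*} [Group H] {R V : Subgroup H}
    [V.Normal] (hR : Group.IsNilpotent R) (h : R ⊓ V ≠ ⊥) :
    ∃ v ∈ V, v ≠ 1 ∧ ∀ r ∈ R, r * v = v * r := by
  classical
  have hex : ∃ n, (Subgroup.upperCentralSeries R n) ⊓ V.subgroupOf R ≠ ⊥ := by
    obtain ⟨n, hn⟩ := hR
    refine ⟨n, ?_⟩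
    rw [hn, top_inf_eq]
    intro hb
    rw [Subgroup.subgroupOf_eq_bot] at hb
    exact h (inf_comm R V ▸ hb.eq_bot)
  obtain ⟨n, hn, hmin⟩ : ∃ n, (Subgroup.upperCentralSeries R n) ⊓ V.subgroupOf R ≠ ⊥ ∧
      ∀ m < n, (Subgroup.upperCentralSeries R m) ⊓ V.subgroupOf R = ⊥ :=
    ⟨Nat.find hex, Nat.find_spec hex, fun m hm => not_not.1 (Nat.find_min hex hm)⟩
  obtain ⟨v, ⟨hvn, hvV⟩, hv1⟩ := (Subgroup.ne_bot_iff_exists_ne_one.1 hn).elim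
    fun v hv => (⟨v, v.2, fun h => hv (Subtype.ext h)⟩ : ∃ v : R,
      v ∈ (Subgroup.upperCentralSeries R n) ⊓ V.subgroupOf R ∧ v ≠ 1)
  refine ⟨v, hvV, fun h => hv1 (Subtype.ext h), fun r hr => ?_⟩
  cases n with
  | zero => exact absurd (Subgroup.mem_bot.1 hvn) hv1
  | succ m =>
    have h1 := Subgroup.mem_upperCentralSeries_succ_iff.1 hvn ⟨r, hr⟩
    have h2 : v * ⟨r, hr⟩ * v⁻¹ * ⟨r, hr⟩⁻¹ ∈
        (Subgroup.upperCentralSeries R m) ⊓ V.subgroupOf R := by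
      refine ⟨h1, ?_⟩
      change (v : H) * r * (v : H)⁻¹ * r⁻¹ ∈ V
      rw [mul_assoc, mul_assoc, ← mul_assoc r]
      exact V.mul_mem hvV (Subgroup.Normal.conj_mem inferInstance _ (V.inv_mem hvV) r)
    rw [hmin m m.lt_succ_self, Subgroup.mem_bot] at h2
    have h3 : (v : H) * r * (v : H)⁻¹ * r⁻¹ = 1 := congrArg Subtype.val h2
    rw [mul_inv_eq_one, mul_inv_eq_iff_eq_mul] at h3
    exact h3.symm

variable [Finite G]

/-- A chief factor is `𝔑 ∘ F`-central if and only if it is centralized by the `F`-residual. -/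
theorem IsChiefFactor.isCentralFactor_iff {K L : Subgroup G} [K.Normal] [L.Normal]
    (hF : F.IsFormation) (hS : F.IsSubgroupClosed) (hc : IsChiefFactor K L) :
    IsCentralFactor (nilpotent.formationProduct F) K L ↔
      F.residual G ≤ (factorAction K L).ker := by
  set ρ := factorAction K L with hρ
  let W := factor K L ⋊[QuotientGroup.kerLift ρ] (G ⧸ ρ.ker)
  let σ : W →* ρ.range := factorSemidirectAction K L
  constructor
  · intro h
    have hnil : Group.IsNilpotent (F.residual W) := h
    have hle : F.residual W ≤ σ.ker := by
      let V : Subgroup W := (SemidirectProduct.inl : factor K L →* W).range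
      have hV : V.Normal := by
        change (SemidirectProduct.inl : factor K L →* W).range.Normal
        rw [SemidirectProduct.range_inl_eq_ker_rightHom]
        infer_instance
      have hcom : ∀ v : factor K L, ∀ r ∈ F.residual W, (σ r : MulAut (factor K L)) v = v := by
        let B : Subgroup (factor K L) :=
          { carrier := {v | ∀ r ∈ F.residual W, (σ r : MulAut (factor K L)) v = v}
            mul_mem' := fun ha hb n hn => by rw [map_mul, ha n hn, hb n hn]
            one_mem' := fun n _ => map_one _
            inv_mem' := fun ha n hn => by rw [map_inv, ha n hn] }
        have hcm : ∀ v r, r * SemidirectProduct.inl v = SemidirectProduct.inl v * r →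
            (σ r : MulAut (factor K L)) v = v := by
          intro v r h1
          have h2 := mul_inl_eq_inl_mul r v
          rw [h1] at h2
          exact (SemidirectProduct.inl_injective (mul_right_cancel h2)).symm
        have hBtop : B = ⊤ := by
          by_cases hb : F.residual W ⊓ V = ⊥
          · refine eq_top_iff.2 fun v _ r hr => hcm v r ?_
            have : r * SemidirectProduct.inl v * r⁻¹ * (SemidirectProduct.inl v)⁻¹ ∈
                F.residual W ⊓ V := by
              constructor
              · rw [mul_assoc, mul_assoc, ← mul_assoc (SemidirectProduct.inl v : W)]
                exact mul_mem hr (Subgroup.Normal.conj_mem inferInstance _ (inv_mem hr) _)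
              · exact mul_mem (hV.conj_mem _ ⟨v, rfl⟩ r) (V.inv_mem ⟨v, rfl⟩)
            rw [hb, Subgroup.mem_bot, mul_inv_eq_one, mul_inv_eq_iff_eq_mul] at this
            exact this
          · obtain ⟨_, ⟨v, rfl⟩, hv1, hv⟩ := exists_ne_one_commute_of_isNilpotent hnil hb
            refine (hc.actsIrreducibly B fun g b hb r hr => ?_).resolve_left fun hbot => ?_
            · obtain ⟨w, hw⟩ := factorSemidirectAction_surjective (K := K) (L := L)
                ⟨ρ g, g, rfl⟩
              have h1 : ρ g = (σ w : MulAut (factor K L)) := (congrArg Subtype.val hw).symm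
              have h2 := hb (w⁻¹ * r * w)
                (by
                  have := Subgroup.Normal.conj_mem (H := F.residual W) inferInstance r hr w⁻¹
                  rwa [inv_inv] at this)
              rw [← hρ, h1, ← MulAut.mul_apply, ← Subgroup.coe_mul, ← map_mul,
                show r * w = w * (w⁻¹ * r * w) by group, map_mul, Subgroup.coe_mul,
                MulAut.mul_apply, h2]
            · have hvB : v ∈ B := fun r hr => hcm v r (hv r hr)
              rw [hbot, Subgroup.mem_bot] at hvB
              exact hv1 (by rw [hvB, map_one])
        exact fun v => (hBtop ▸ Subgroup.mem_top v : v ∈ B)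
      intro r hr
      refine Subtype.ext ?_
      ext v : 1
      exact hcom v r hr
    have hmem : F.Mem ρ.range :=
      hF.mem_of_residual_le_ker σ factorSemidirectAction_surjective hle
    have := hS.residual_le_ker ρ.rangeRestrict hmem
    rwa [MonoidHom.ker_rangeRestrict] at this
  · intro h
    have hmem : F.Mem (G ⧸ ρ.ker) :=
      hF.mem_of_residual_le_ker (QuotientGroup.mk' ρ.ker) (QuotientGroup.mk'_surjective _)
        (by rwa [QuotientGroup.ker_mk'])
    have h1 : F.residual W ≤ (SemidirectProduct.rightHom : W →* _).ker :=
      hS.residual_le_ker _ hmem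
    have h2 : F.residual W ≤ σ.ker :=
      hS.residual_le_ker σ (F.mem_of_mulEquiv (QuotientGroup.quotientKerEquivRange ρ) hmem)
    change Group.IsNilpotent (F.residual W)
    refine Subgroup.isNilpotent_of_ker_le_center (1 : F.residual W →* Unit) ?_
    rintro ⟨x, hx⟩ -
    rw [Subgroup.mem_center_iff]
    rintro ⟨y, hy⟩
    refine Subtype.ext ?_
    change y * x = x * y
    have hx1 : x.right = 1 := h1 hx
    have hxl : x = SemidirectProduct.inl x.left := by
      ext
      · rfl
      · exact hx1
    have h3 := mul_inl_eq_inl_mul y x.left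
    have h4 : (σ y : MulAut (factor K L)) = 1 := congrArg Subtype.val (h2 hy)
    change _ = SemidirectProduct.inl ((σ y : MulAut (factor K L)) x.left) * y at h3
    rwa [h4, MulAut.one_apply, ← hxl] at h3

end GroupClass

namespace GroupClass

variable {F : GroupClass.{u}} {π : Set Nat.Primes} {G : Type u} [Group G]

theorem card_factor (K L : Subgroup G) [K.Normal] : Nat.card (factor K L) = K.relIndex L := by
  rw [factor, ← Subgroup.relIndex_ker, QuotientGroup.ker_mk']

theorem map_mk'_sup (U N : Subgroup G) [N.Normal] :
    (U ⊔ N).map (QuotientGroup.mk' N) = U.map (QuotientGroup.mk' N) := by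
  rw [Subgroup.map_sup, (Subgroup.map_eq_bot_iff N).2 (QuotientGroup.ker_mk' N).ge, sup_bot_eq]

variable [Finite G]

theorem isHypercentral_iff (hF : F.IsFormation) (hS : F.IsSubgroupClosed) {N : Subgroup G} :
    IsHypercentral π (nilpotent.formationProduct F) N ↔ N.Normal ∧
      ∀ (K L : Subgroup G) [K.Normal] [L.Normal], IsChiefFactor K L → L ≤ N →
        (∃ p ∈ π, (p : ℕ) ∣ Nat.card (factor K L)) →
          F.residual G ≤ (factorAction K L).ker := by
  refine and_congr_right fun _ => ?_
  constructor
  · intro h K L _ _ hc hL hp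
    exact (hc.isCentralFactor_iff hF hS).1 (h K L hc hL hp)
  · intro h K L _ _ hc hL hp
    exact (hc.isCentralFactor_iff hF hS).2 (h K L hc hL hp)

theorem exists_isChiefFactor_above {M N : Subgroup G} (hM : M.Normal) (hN : N.Normal)
    (h : M < N) : ∃ L : Subgroup G, IsChiefFactor M L ∧ L ≤ N := by
  let S : Set (Subgroup G) := {L | L.Normal ∧ M < L ∧ L ≤ N}
  obtain ⟨L, ⟨hL, hML, hLN⟩, hmin⟩ := (Set.toFinite S).exists_minimal ⟨N, hN, h, le_rfl⟩
  refine ⟨L, ⟨hM, hL, hML, fun A hA hMA hAL => ?_⟩, hLN⟩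
  rcases hMA.eq_or_lt with h1 | h1
  · exact Or.inl h1.symm
  · exact Or.inr (le_antisymm hAL (hmin (y := A) ⟨hA, h1, hAL.trans hLN⟩ hAL))

theorem exists_isChiefFactor_below {M N : Subgroup G} (hM : M.Normal) (hN : N.Normal)
    (h : M < N) : ∃ K : Subgroup G, IsChiefFactor K N ∧ M ≤ K := by
  let S : Set (Subgroup G) := {K | K.Normal ∧ K < N ∧ M ≤ K}
  obtain ⟨K, ⟨hK, hKN, hMK⟩, hmax⟩ := (Set.toFinite S).exists_maximal ⟨M, hM, h, le_rfl⟩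
  refine ⟨K, ⟨hK, hN, hKN, fun A hA hKA hAN => ?_⟩, hMK⟩
  rcases hAN.eq_or_lt with h1 | h1
  · exact Or.inr h1
  · exact Or.inl (le_antisymm (hmax (y := A) ⟨hA, h1, hMK.trans hKA⟩ hKA) hKA)

/-- A subgroup that lies in `𝔑_π ∘ F` modulo a hypercentral normal subgroup lies in
`𝔑_π ∘ F`. -/
theorem IsHypercentral.mem_of_map (hF : F.IsFormation) (hS : F.IsSubgroupClosed)
    {N : Subgroup G} [hNn : N.Normal] (hN : IsHypercentral π (nilpotent.formationProduct F) N)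
    {H : Subgroup G}
    (hH : ((piNilpotent π).formationProduct F).Mem (H.map (QuotientGroup.mk' N))) :
    ((piNilpotent π).formationProduct F).Mem H := by
  replace hN := ((isHypercentral_iff hF hS).1 hN).2
  rw [piNilpotent_formationProduct_mem_iff] at hH ⊢
  intro p hp
  have := Fact.mk p.2
  set R := F.subgroupResidual H with hR
  let S : Set (Subgroup G) := {M | M ≤ N ∧ ∃ _ : M.Normal,
    IsPNilpotent p (R.map (QuotientGroup.mk' M))}
  have hSne : S.Nonempty := by
    refine ⟨N, le_rfl, hNn, ?_⟩
    rw [hR, ← hF.subgroupResidual_map_hom hS]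
    exact hH p hp
  obtain ⟨M, ⟨hMN, hM, hMp⟩, hmin⟩ := (Set.toFinite S).exists_minimal hSne
  have hbot : M = ⊥ := by
    by_contra hne
    obtain ⟨K, hc, -⟩ := exists_isChiefFactor_below inferInstance hM (bot_lt_iff_ne_bot.2 hne)
    have hKn := hc.normal_bot
    refine hc.lt.not_ge (hmin (y := K) ⟨hc.lt.le.trans hMN, hKn, ?_⟩ hc.lt.le)
    let g : G ⧸ K →* G ⧸ M := QuotientGroup.map K M (MonoidHom.id G) hc.lt.le
    have hg : (R.map (QuotientGroup.mk' K)).map g = R.map (QuotientGroup.mk' M) := by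
      rw [Subgroup.map_map]
      rfl
    rw [← hg] at hMp
    have hker : ∀ x : R.map (QuotientGroup.mk' K),
        x ∈ (g.subgroupMap (R.map (QuotientGroup.mk' K))).ker → ∃ r ∈ R, r ∈ M ∧
          QuotientGroup.mk' K r = x := by
      rintro ⟨_, r, hr, rfl⟩ hx
      exact ⟨r, hr, (QuotientGroup.eq_one_iff r).1 (congrArg Subtype.val hx), rfl⟩
    by_cases hd : (p : ℕ) ∣ Nat.card (factor K M)
    · have hcen := hN K M hc hMN ⟨p, hp, hd⟩
      refine hMp.of_ker_le_center (g.subgroupMap (R.map (QuotientGroup.mk' K))) fun x hx => ?_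
      obtain ⟨r, -, hrM, hrx⟩ := hker x hx
      rw [Subgroup.mem_center_iff]
      rintro ⟨_, s, hs, rfl⟩
      refine Subtype.ext ?_
      change QuotientGroup.mk' K s * (x : G ⧸ K) = (x : G ⧸ K) * QuotientGroup.mk' K s
      have h1 := mem_ker_factorAction.1 (hcen (hF.subgroupResidual_le_residual hS _ hs)) r hrM
      rw [← hrx, ← mul_inv_eq_iff_eq_mul, ← mul_inv_eq_one, ← map_mul, ← map_inv, ← map_inv,
        ← map_mul, ← map_mul]
      exact (QuotientGroup.eq_one_iff _).2 h1
    · refine hMp.of_not_dvd_card_ker (g.subgroupMap (R.map (QuotientGroup.mk' K))) fun hd' =>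
        hd (hd'.trans ?_)
      rw [Nat.card_congr (Subgroup.equivMapOfInjective _ _
        (R.map (QuotientGroup.mk' K)).subtype_injective).toEquiv]
      refine Subgroup.card_dvd_of_le ?_
      rintro _ ⟨x, hx, rfl⟩
      obtain ⟨r, -, hrM, hrx⟩ := hker x hx
      exact ⟨r, hrM, hrx⟩
  subst hbot
  refine hMp.of_injective ((QuotientGroup.mk' ⊥).subgroupMap R) ?_
  rintro ⟨a, ha⟩ ⟨b, hb⟩ hab
  have h1 := QuotientGroup.eq.1 (congrArg Subtype.val hab)
  exact Subtype.ext (inv_mul_eq_one.1 (Subgroup.mem_bot.1 h1))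

/-- The product of an `𝔑_π ∘ F`-subgroup and a hypercentral normal subgroup lies in
`𝔑_π ∘ F`. -/
theorem IsHypercentral.mem_sup (hF : F.IsFormation) (hS : F.IsSubgroupClosed) {N U : Subgroup G}
    (hN : IsHypercentral π (nilpotent.formationProduct F) N)
    (hU : ((piNilpotent π).formationProduct F).Mem U) :
    ((piNilpotent π).formationProduct F).Mem (U ⊔ N : Subgroup G) := by
  have := hN.1
  refine hN.mem_of_map hF hS ?_
  rw [map_mk'_sup]
  exact hF.piNilpotent_formationProduct_image hS _ hU

theorem IsHypercentral.mono {X : GroupClass.{u}} {M N : Subgroup G}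
    (hN : IsHypercentral π X N) (hM : M.Normal) (h : M ≤ N) : IsHypercentral π X M :=
  ⟨hM, fun K L _ _ hc hL hp => hN.2 K L hc (hL.trans h) hp⟩

theorem IsHypercentral.le_maximalInter (hF : F.IsFormation) (hS : F.IsSubgroupClosed)
    {N : Subgroup G} (hN : IsHypercentral π (nilpotent.formationProduct F) N) :
    N ≤ ((piNilpotent π).formationProduct F).maximalInter G :=
  le_sInf fun _ hU => le_sup_right.trans (hU.2 (hN.mem_sup hF hS hU.1) le_sup_left)

section MaximalInter

variable {X : GroupClass.{u}}

theorem exists_maximal_of_mem {T : Subgroup G} (hT : X.Mem T) :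
    ∃ U : Subgroup G, T ≤ U ∧ Maximal (fun V : Subgroup G => X.Mem V) U :=
  (Set.toFinite {V : Subgroup G | X.Mem V}).exists_le_maximal hT

instance maximalInter_normal (X : GroupClass.{u}) (G : Type u) [Group G] [Finite G] :
    (X.maximalInter G).Normal := by
  refine ⟨fun n hn g => ?_⟩
  rw [maximalInter, Subgroup.mem_sInf]
  intro U hU
  have hmem : ∀ (h : G) (V : Subgroup G), X.Mem V →
      X.Mem (V.map (MulAut.conj h : G ≃* G).toMonoidHom) :=
    fun h V hV => X.mem_of_mulEquiv ((MulAut.conj h).subgroupMap V) hV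
  have hcc : ∀ (h : G) (V : Subgroup G), (V.map (MulAut.conj h : G ≃* G).toMonoidHom).map
      (MulAut.conj h⁻¹ : G ≃* G).toMonoidHom = V := by
    intro h V
    rw [Subgroup.map_map]
    convert Subgroup.map_id V
    ext x
    simp [mul_assoc]
  have hU' : Maximal (fun V : Subgroup G => X.Mem V)
      (U.map (MulAut.conj g⁻¹ : G ≃* G).toMonoidHom) := by
    refine ⟨hmem _ _ hU.1, fun V hV hle => ?_⟩
    have h1 := Subgroup.map_mono (f := (MulAut.conj g : G ≃* G).toMonoidHom) hle
    have h2 := hcc g⁻¹ U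
    rw [inv_inv] at h2
    rw [h2] at h1
    have h3 := Subgroup.map_mono (f := (MulAut.conj g⁻¹ : G ≃* G).toMonoidHom)
      (hU.2 (hmem g V hV) h1)
    rwa [hcc] at h3
  obtain ⟨u, hu, hun⟩ := (Subgroup.mem_sInf.1 hn) _ hU'
  have : g * n * g⁻¹ = u := by
    rw [← hun]
    simp [mul_assoc]
  rwa [this]

end MaximalInter

theorem isHypercentral_maximalInter (hF : F.IsFormation) (hS : F.IsSubgroupClosed)
    (h3 : BoundaryConditionIII π F) : IsHypercentral π (nilpotent.formationProduct F)
      (((piNilpotent π).formationProduct F).maximalInter G) := by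
  rw [isHypercentral_iff hF hS]
  refine ⟨inferInstance, ?_⟩
  rintro K L _ _ hc hL ⟨p, hp, hd⟩
  refine hc.residual_le_ker hF hS h3 hp hd fun T hT => ?_
  obtain ⟨U, hTU, hU⟩ := exists_maximal_of_mem hT
  refine ⟨F.subgroupResidual U, hF.subgroupResidual_mono hS hTU,
    (piNilpotent_formationProduct_mem_iff π F U).1 hU.1 p hp, ?_⟩
  exact (hL.trans (sInf_le hU)).trans (F.le_normalizer_subgroupResidual U)

end GroupClass

namespace GroupClass

variable {F : GroupClass.{u}} {π : Set Nat.Primes} {G : Type u} [Group G] [Finite G]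

instance normSeries_normal (X F : GroupClass.{u}) (G : Type u) [Group G] [Finite G] (i : ℕ) :
    (normSeries X F G i).Normal :=
  (normSeriesAux X F G i).2

theorem normSeries_succ (X F : GroupClass.{u}) (G : Type u) [Group G] [Finite G] (i : ℕ) :
    normSeries X F G (i + 1) = (norm X F (G ⧸ normSeries X F G i)).comap
      (QuotientGroup.mk' (normSeries X F G i)) := rfl

theorem normSeries_mono (X F : GroupClass.{u}) (G : Type u) [Group G] [Finite G] :
    Monotone (normSeries X F G) := by
  refine monotone_nat_of_le_succ fun i => ?_
  rw [normSeries_succ]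
  intro x hx
  rw [Subgroup.mem_comap, show QuotientGroup.mk' (normSeries X F G i) x = 1 from
    (QuotientGroup.eq_one_iff x).2 hx]
  exact Subgroup.one_mem _

theorem radical_le_norm (X F : GroupClass.{u}) (G : Type u) [Group G] [Finite G] :
    X.radical G ≤ norm X F G :=
  le_iInf fun _ => le_sup_right.trans Subgroup.le_normalizer

theorem mem_norm_of_commute (hF : F.IsFormation) (hS : F.IsSubgroupClosed) {X : GroupClass.{u}}
    {x : G} (h : ∀ s ∈ F.residual G, x * s * x⁻¹ = s) : x ∈ norm X F G := by
  refine Subgroup.mem_iInf.2 fun K =>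
    Subgroup.normalizer_inf_normalizer_le_normalizer_sup _ _ ⟨?_, ?_⟩
  · refine Subgroup.mem_normalizer_fintype fun s hs => ?_
    rwa [h s (hF.subgroupResidual_le_residual hS K hs)]
  · rw [Subgroup.normalizer_eq_top]
    trivial

theorem IsHypercentral.le_piNormInfty (hF : F.IsFormation) (hS : F.IsSubgroupClosed)
    {N : Subgroup G} (hN : IsHypercentral π (nilpotent.formationProduct F) N) :
    N ≤ piNormInfty πᶜ F G := by
  obtain ⟨hNn, hN⟩ := (isHypercentral_iff hF hS).1 hN
  obtain ⟨i, hi⟩ := WellFoundedGT.monotone_chain_condition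
    ⟨normSeries (piGroups πᶜ) F G, normSeries_mono _ _ _⟩
  have hi1 : normSeries (piGroups πᶜ) F G i = normSeries (piGroups πᶜ) F G (i + 1) :=
    hi (i + 1) i.le_succ
  refine le_trans ?_ (le_iSup (normSeries (piGroups πᶜ) F G) i)
  rw [normSeries_succ] at hi1
  set T := normSeries (piGroups πᶜ) F G i with hT
  by_contra hle
  obtain ⟨L, hc, hLN⟩ := exists_isChiefFactor_above (M := N ⊓ T) inferInstance hNn
    (lt_of_le_of_ne inf_le_left fun h => hle (inf_eq_left.1 h))
  have hLn := hc.normal_top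
  refine hc.lt.not_ge (le_inf hLN (le_trans (fun l hl => ?_) hi1.ge))
  rw [Subgroup.mem_comap]
  by_cases hp : ∃ p ∈ π, (p : ℕ) ∣ Nat.card (factor (N ⊓ T) L)
  · have hcen := hN _ _ hc hLN hp
    refine mem_norm_of_commute hF hS fun s hs => ?_
    rw [← hF.map_residual hS (QuotientGroup.mk' T) (QuotientGroup.mk'_surjective T)] at hs
    obtain ⟨r, hr, rfl⟩ := hs
    have h1 := (mem_ker_factorAction.1 (hcen hr) l hl).2
    have h2 : QuotientGroup.mk' T (r * l * r⁻¹ * l⁻¹) = 1 := (QuotientGroup.eq_one_iff _).2 h1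
    rw [map_mul, map_mul, map_mul, map_inv, map_inv, mul_inv_eq_one, mul_inv_eq_iff_eq_mul] at h2
    rw [← h2, mul_inv_cancel_right]
  · have hle : L.map (QuotientGroup.mk' T) ≤ (piGroups πᶜ).radical (G ⧸ T) := by
      refine le_sSup ⟨hLn.map _ (QuotientGroup.mk'_surjective T), ?_⟩
      intro p hpd hpπ
      refine hp ⟨p, hpπ, hpd.trans ?_⟩
      change Nat.card (factor T L) ∣ _
      rw [card_factor, card_factor]
      exact Subgroup.relIndex_dvd_of_le_left L inf_le_right
    exact radical_le_norm _ _ _ (hle ⟨l, hl, rfl⟩)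

theorem isHypercentral_norm (hF : F.IsFormation) (hS : F.IsSubgroupClosed)
    (h3 : BoundaryConditionIII π F) :
    IsHypercentral π (nilpotent.formationProduct F) (norm (piGroups πᶜ) F G) := by
  rw [isHypercentral_iff hF hS]
  refine ⟨inferInstance, ?_⟩
  rintro K L _ _ hc hL ⟨p, hp, hd⟩
  refine hc.residual_le_ker hF hS h3 hp hd fun T hT => ?_
  have := Fact.mk p.2
  let O := (piGroups πᶜ).radical G
  refine ⟨F.subgroupResidual T ⊔ O, le_sup_left, ?_, hL.trans (iInf_le _ T)⟩
  have h1 : IsPNilpotent p ((F.subgroupResidual T ⊔ O).map (QuotientGroup.mk' O)) := by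
    rw [map_mk'_sup]
    exact ((piNilpotent_formationProduct_mem_iff π F T).1 hT p hp).of_surjective _
      (MonoidHom.subgroupMap_surjective _ _)
  refine h1.of_not_dvd_card_ker
    ((QuotientGroup.mk' O).subgroupMap (F.subgroupResidual T ⊔ O)) fun hdvd => ?_
  refine piGroups_radical_mem πᶜ G p (hdvd.trans ?_) hp
  rw [Nat.card_congr (Subgroup.equivMapOfInjective _ _
    (F.subgroupResidual T ⊔ O).subtype_injective).toEquiv]
  refine Subgroup.card_dvd_of_le ?_
  rintro _ ⟨x, hx, rfl⟩
  exact (QuotientGroup.eq_one_iff _).1 (congrArg Subtype.val hx)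

theorem isHypercentral_normSeries (hF : F.IsFormation) (hS : F.IsSubgroupClosed)
    (h3 : BoundaryConditionIII π F) (i : ℕ) :
    IsHypercentral π (nilpotent.formationProduct F) (normSeries (piGroups πᶜ) F G i) := by
  induction i with
  | zero =>
    refine ⟨inferInstance, fun K L _ _ hc hL _ => ?_⟩
    exact absurd (hL.trans bot_le) hc.lt.not_ge
  | succ i ih =>
    refine (isHypercentral_maximalInter hF hS h3).mono inferInstance (le_sInf fun U hU => ?_)
    refine le_sup_right.trans (hU.2 (ih.mem_of_map hF hS ?_) le_sup_left)
    rw [Subgroup.map_sup, normSeries_succ,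
      Subgroup.map_comap_eq_self_of_surjective (QuotientGroup.mk'_surjective _)]
    exact (isHypercentral_norm hF hS h3).mem_sup hF hS
      (hF.piNilpotent_formationProduct_image hS _ hU.1)

theorem piNormInfty_le_maximalInter (hF : F.IsFormation) (hS : F.IsSubgroupClosed)
    (h3 : BoundaryConditionIII π F) :
    piNormInfty πᶜ F G ≤ ((piNilpotent π).formationProduct F).maximalInter G :=
  iSup_le fun i => (isHypercentral_normSeries hF hS h3 i).le_maximalInter hF hS

end GroupClass

/-- A `p'`-element of prime order acts non-trivially on some irreducible abelian `p`-group. -/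
theorem exists_actsIrreducibly {G : Type u} [Group G] [Finite G] {p q : ℕ} [hp : Fact p.Prime]
    (hq : q.Coprime p) {g : G} (hgq : g ^ q = 1) (hg : g ≠ 1) :
    ∃ (V : Type u) (_ : CommGroup V) (_ : Finite V) (φ : G →* MulAut V),
      IsPGroup p V ∧ ActsIrreducibly φ ∧ φ g ≠ 1 := by
  classical
  let P : ℕ → Prop := fun n => ∃ (V : Type u) (_ : CommGroup V) (_ : Finite V)
    (_ : MulDistribMulAction G V), Nat.card V = n ∧ IsPGroup p V ∧ ∃ v : V, g • v ≠ v
  have hex : ∃ n, P n := by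
    let V := G → Multiplicative (ZMod p)
    let : MulDistribMulAction G V := arrowMulDistribMulAction
    refine ⟨_, V, inferInstance, inferInstance, inferInstance, rfl, ?_,
      Pi.mulSingle 1 (Multiplicative.ofAdd 1), ?_⟩
    · refine fun v => ⟨1, funext fun x => ?_⟩
      rw [pow_one]
      exact Multiplicative.toAdd.injective
        (show p • (v x).toAdd = 0 by rw [nsmul_eq_mul, CharP.cast_eq_zero, zero_mul])
    · intro h
      have h1 := congrFun h g
      change Pi.mulSingle (M := fun _ : G => Multiplicative (ZMod p)) 1
        (Multiplicative.ofAdd 1) (g⁻¹ * g) = _ at h1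
      rw [inv_mul_cancel, Pi.mulSingle_eq_same, Pi.mulSingle_eq_of_ne hg] at h1
      exact one_ne_zero (α := ZMod p) (Multiplicative.ofAdd.injective h1)
  obtain ⟨V, _, _, _, hcard, hV, v, hv⟩ := Nat.find_spec hex
  have hmin := fun n (hn : P n) => Nat.find_min' hex hn
  rw [← hcard] at hmin
  refine ⟨V, inferInstance, inferInstance, MulDistribMulAction.toMulAut G V, hV, ?_, fun h => ?_⟩
  · intro B hB
    replace hB : ∀ (x : G), ∀ b ∈ B, x • b ∈ B := hB
    by_contra hcon
    rw [not_or] at hcon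
    let : MulDistribMulAction G B :=
      { smul := fun x b => ⟨x • (b : V), hB x b b.2⟩
        one_smul := fun b => Subtype.ext (one_smul G (b : V))
        mul_smul := fun x y b => Subtype.ext (mul_smul x y (b : V))
        smul_mul := fun x b c => Subtype.ext (smul_mul' x (b : V) c)
        smul_one := fun x => Subtype.ext (smul_one x) }
    let : MulDistribMulAction G (V ⧸ B) :=
      { smul := fun x => QuotientGroup.map B B (MulDistribMulAction.toMonoidHom V x) (hB x)
        one_smul := fun b => by
          obtain ⟨b, rfl⟩ := QuotientGroup.mk'_surjective B b
          exact congrArg (QuotientGroup.mk' B) (one_smul G b)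
        mul_smul := fun x y b => by
          obtain ⟨b, rfl⟩ := QuotientGroup.mk'_surjective B b
          exact congrArg (QuotientGroup.mk' B) (mul_smul x y b)
        smul_mul := fun x b c => map_mul _ b c
        smul_one := fun x => map_one _ }
    have hBtriv : ∀ b ∈ B, g • b = b := by
      intro b hb
      by_contra hne
      refine absurd (hmin _ ⟨B, inferInstance, inferInstance, inferInstance, rfl,
        hV.to_subgroup B, ⟨b, hb⟩, fun h => hne (congrArg Subtype.val h)⟩) (not_le.2 ?_)
      exact lt_of_le_of_ne (Subgroup.card_le_card_group B)
        fun h => hcon.2 (Subgroup.eq_top_of_card_eq B h)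
    have hQtriv : ∀ w : V, w⁻¹ * g • w ∈ B := by
      intro w
      by_contra hne
      refine absurd (hmin _ ⟨V ⧸ B, inferInstance, inferInstance, inferInstance, rfl,
        hV.to_quotient B, QuotientGroup.mk' B w, fun h => hne ?_⟩) (not_le.2 ?_)
      · exact QuotientGroup.eq.1 (Eq.symm h)
      · rw [B.card_eq_card_quotient_mul_card_subgroup]
        exact lt_mul_of_one_lt_right Nat.card_pos ((Subgroup.one_lt_card_iff_ne_bot B).2 hcon.1)
    have hpow : ∀ n : ℕ, g ^ n • v = v * (v⁻¹ * g • v) ^ n := by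
      intro n
      induction n with
      | zero => simp
      | succ n ih =>
        rw [pow_succ', mul_smul, ih, smul_mul', hBtriv _ (B.pow_mem (hQtriv v) n), pow_succ']
        rw [← mul_assoc, mul_inv_cancel_left]
    have h1 := hpow q
    rw [hgq, one_smul, left_eq_mul] at h1
    obtain ⟨k, hk⟩ := hV (v⁻¹ * g • v)
    have h2 : v⁻¹ * g • v ∈ (⊥ : Subgroup V) := IsPNilpotent.mem_of_pow_mem hq
      (Subgroup.mem_bot.2 h1) (Subgroup.mem_bot.2 hk)
    exact hv (inv_mul_eq_one.1 (Subgroup.mem_bot.1 h2)).symm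
  · exact hv (congrArg (fun e : MulAut V => e v) h)

theorem SemidirectProduct.right_mem_ker_of_disjoint {G V : Type*} [Group G] [CommGroup V]
    {φ : G →* MulAut V} {N : Subgroup (V ⋊[φ] G)} (hN : N.Normal)
    (h : ∀ v : V, SemidirectProduct.inl v ∈ N → v = 1) {x : V ⋊[φ] G} (hx : x ∈ N) :
    φ x.right = 1 := by
  ext w
  have h1 : (x * SemidirectProduct.inl w * x⁻¹) * (SemidirectProduct.inl w)⁻¹ =
      SemidirectProduct.inl (φ x.right w * w⁻¹) := by
    ext <;> simp
  have h2 : (x * SemidirectProduct.inl w * x⁻¹) * (SemidirectProduct.inl w)⁻¹ ∈ N := by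
    rw [mul_assoc, mul_assoc, ← mul_assoc (SemidirectProduct.inl w : V ⋊[φ] G)]
    exact N.mul_mem hx (hN.conj_mem _ (N.inv_mem hx) _)
  rw [h1] at h2
  exact mul_inv_eq_one.1 (h _ h2)

namespace GroupClass

variable {F : GroupClass.{u}} {π : Set Nat.Primes} {G V : Type u} [Group G] [Finite G]
  [CommGroup V] [Finite V] {φ : G →* MulAut V} {p : Nat.Primes}

theorem inl_range_le_maximalInter (hF : F.IsFormation) (hS : F.IsSubgroupClosed)
    (hG : IsCritical ((piGroups {p}).formationProduct F) G)
    (hGX : ¬ ((piNilpotent π).formationProduct F).Mem G) (hV : IsPGroup p V) :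
    (SemidirectProduct.inl : V →* V ⋊[φ] G).range ≤
      ((piNilpotent π).formationProduct F).maximalInter (V ⋊[φ] G) := by
  refine le_sInf fun U hU => ?_
  let r : V ⋊[φ] G →* G := SemidirectProduct.rightHom
  set B := (SemidirectProduct.inl : V →* V ⋊[φ] G).range with hB
  have hBr : B = r.ker := SemidirectProduct.range_inl_eq_ker_rightHom
  have hT : U.map r < ⊤ := by
    refine lt_top_iff_ne_top.2 fun h => hGX ?_
    have h1 := hF.piNilpotent_formationProduct_image hS r hU.1
    rw [h] at h1
    exact GroupClass.mem_of_mulEquiv _ Subgroup.topEquiv h1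
  have hTp := (piGroups_formationProduct_mem_iff p F _).1 (hG.2 _ hT)
  have hp := Fact.mk p.2
  have hpg : IsPGroup p (F.subgroupResidual (U ⊔ B)) := by
    have h1 : (F.subgroupResidual (U ⊔ B)).map r = F.subgroupResidual (U.map r) := by
      rw [← hF.subgroupResidual_map_hom hS, Subgroup.map_sup, (Subgroup.map_eq_bot_iff B).2 hBr.le,
        sup_bot_eq]
    have hk : IsPGroup p r.ker := by
      rw [← hBr]
      exact hV.of_surjective _ (MonoidHom.rangeRestrict_surjective _)
    exact (hTp.comap_of_ker_isPGroup r hk).to_le (Subgroup.map_le_iff_le_comap.1 h1.le)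
  refine le_sup_right.trans (hU.2 ?_ le_sup_left)
  change ((piNilpotent π).formationProduct F).Mem (U ⊔ B : Subgroup _)
  rw [piNilpotent_formationProduct_mem_iff]
  intro q _
  have := Fact.mk q.2
  exact Group.IsNilpotent.isPNilpotent hpg.isNilpotent

/-- If the `F`-residual of `G` acts non-trivially on the irreducible abelian `p`-group `V`, then
the norm series of `V ⋊ G` stays inside `C_G(V)`. -/
theorem normSeries_semidirectProduct (hF : F.IsFormation) (hS : F.IsSubgroupClosed) (hp : p ∈ π)
    (hV : IsPGroup p V) (hφ : ActsIrreducibly φ) (hres : ∃ s ∈ F.residual G, φ s ≠ 1) (i : ℕ) :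
    ∀ x ∈ normSeries (piGroups πᶜ) F (V ⋊[φ] G) i, x.left = 1 ∧ φ x.right = 1 := by
  have := Fact.mk p.2
  induction i with
  | zero =>
    intro x hx
    rw [Subgroup.mem_bot.1 hx]
    simp
  | succ i ih =>
    rw [normSeries_succ]
    set T := normSeries (piGroups πᶜ) F (V ⋊[φ] G) i with hT
    let q := QuotientGroup.mk' T
    have hq : Function.Surjective q := QuotientGroup.mk'_surjective T
    have hfix : ∀ B : Subgroup V, (∀ g, ∀ b ∈ B, φ g b ∈ B) →
        (∀ b ∈ B, ∀ s ∈ F.residual G, φ s b = b) → B = ⊥ := by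
      intro B hB hBs
      refine (hφ B hB).resolve_right fun htop => ?_
      obtain ⟨s, hs, hs1⟩ := hres
      exact hs1 (by ext v; exact hBs v (htop ▸ Subgroup.mem_top v) s hs)
    let O : Subgroup (V ⋊[φ] G) := ((piGroups πᶜ).radical ((V ⋊[φ] G) ⧸ T)).comap q
    have hOn : O.Normal := Subgroup.Normal.comap inferInstance q
    have hcop : (Nat.card ((piGroups πᶜ).radical ((V ⋊[φ] G) ⧸ T))).Coprime p :=
      ((Nat.Prime.coprime_iff_not_dvd p.2).2 fun h =>
        piGroups_radical_mem πᶜ ((V ⋊[φ] G) ⧸ T) p h hp).symm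
    have hOpow : ∀ x ∈ O, x ^ Nat.card ((piGroups πᶜ).radical ((V ⋊[φ] G) ⧸ T)) ∈ T := by
      intro x hx
      have h1 : (⟨q x, hx⟩ : (piGroups πᶜ).radical ((V ⋊[φ] G) ⧸ T)) ^
        Nat.card ((piGroups πᶜ).radical ((V ⋊[φ] G) ⧸ T)) = 1 := pow_card_eq_one'
      have h2 := congrArg Subtype.val h1
      refine (QuotientGroup.eq_one_iff _).1 ?_
      exact (map_pow q x _).trans h2
    have hVbot : ∀ v : V, v ^ Nat.card ((piGroups πᶜ).radical ((V ⋊[φ] G) ⧸ T)) = 1 → v = 1 := by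
      intro v h1
      obtain ⟨k, hk⟩ := hV v
      exact Subgroup.mem_bot.1 (IsPNilpotent.mem_of_pow_mem hcop (Subgroup.mem_bot.2 h1)
        (Subgroup.mem_bot.2 hk))
    have hOker : ∀ x ∈ O, φ x.right = 1 := fun x hx => by
      refine SemidirectProduct.right_mem_ker_of_disjoint hOn (fun v hv => hVbot v ?_) hx
      have := (ih _ (hOpow _ hv)).1
      rwa [← map_pow, SemidirectProduct.left_inl] at this
    have hO1 : ∀ x ∈ O, x.left = 1 := by
      intro x hx
      refine hVbot _ ?_
      have h1 := (ih _ (hOpow x hx)).1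
      have h2 : ∀ n : ℕ, (x ^ n).left = x.left ^ n := by
        intro n
        induction n with
        | zero => simp
        | succ n ihn => rw [pow_succ', SemidirectProduct.mul_left, hOker x hx, ihn, pow_succ']; rfl
      rwa [h2] at h1
    set N : Subgroup (V ⋊[φ] G) :=
      (norm (piGroups πᶜ) F ((V ⋊[φ] G) ⧸ T)).comap (QuotientGroup.mk' T) with hN
    have hNn : N.Normal := Subgroup.Normal.comap inferInstance _
    have hNs : ∀ x ∈ N, ∀ s ∈ F.residual G,
        (x * SemidirectProduct.inr s * x⁻¹).left = 1 := by
      intro x hx s hs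
      let j : G →* V ⋊[φ] G := SemidirectProduct.inr
      have h1 := Subgroup.mem_iInf.1 hx (((⊤ : Subgroup G).map j).map q)
      rw [hF.subgroupResidual_map_hom hS, hF.subgroupResidual_map_hom hS,
        subgroupResidual_top] at h1
      have h2 := (Subgroup.mem_normalizer_iff.1 h1 (q (j s))).1
        (Subgroup.mem_sup_left ⟨_, ⟨s, hs, rfl⟩, rfl⟩)
      have h3 : ((F.residual G).map j).map q ⊔ (piGroups πᶜ).radical ((V ⋊[φ] G) ⧸ T) =
          (((F.residual G).map j) ⊔ O).map q := by
        rw [Subgroup.map_sup, Subgroup.map_comap_eq_self_of_surjective hq]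
      have h4 : x * j s * x⁻¹ ∈ ((((F.residual G).map j) ⊔ O).map q).comap q := by
        rw [← h3]
        exact h2
      rw [Subgroup.comap_map_eq_self] at h4
      · have h5 : (F.residual G).map j ⊔ O ≤ j.range := by
          refine sup_le ?_ fun y hy => ⟨y.right, ?_⟩
          · rintro _ ⟨y, -, rfl⟩
            exact ⟨y, rfl⟩
          · ext
            · exact (hO1 y hy).symm
            · rfl
        obtain ⟨y, hy⟩ := h5 h4
        change (x * j s * x⁻¹).left = 1
        rw [← hy]
        rfl
      · refine le_sup_of_le_right ?_
        rw [← MonoidHom.comap_bot]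
        exact Subgroup.comap_mono bot_le
    have hNV : ∀ v : V, SemidirectProduct.inl v ∈ N → v = 1 := by
      let B : Subgroup V := N.comap SemidirectProduct.inl
      have hB : B = ⊥ := by
        refine hfix B (fun g b hb => ?_) fun b hb s hs => ?_
        · have : (SemidirectProduct.inl (φ g b) : V ⋊[φ] G) ∈ N := by
            rw [SemidirectProduct.inl_aut, map_inv]
            exact hNn.conj_mem _ hb _
          exact this
        · have := hNs _ hb s hs
          simp only [SemidirectProduct.mul_left, SemidirectProduct.inv_left] at this
          simp at this
          exact (mul_inv_eq_one.1 this).symm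
      intro v hv
      have : v ∈ B := hv
      rwa [hB, Subgroup.mem_bot] at this
    have hNker : ∀ x ∈ N, φ x.right = 1 := fun x hx =>
      SemidirectProduct.right_mem_ker_of_disjoint hNn hNV hx
    let B : Subgroup V :=
      { carrier := {v | ∃ x ∈ N, x.left = v}
        mul_mem' := by
          rintro _ _ ⟨x, hx, rfl⟩ ⟨y, hy, rfl⟩
          exact ⟨x * y, N.mul_mem hx hy, by simp [hNker x hx]⟩
        one_mem' := ⟨1, N.one_mem, rfl⟩
        inv_mem' := by
          rintro _ ⟨x, hx, rfl⟩
          exact ⟨x⁻¹, N.inv_mem hx, by simp [hNker x hx]⟩ }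
    have hB : B = ⊥ := by
      refine hfix B ?_ ?_
      · rintro g _ ⟨x, hx, rfl⟩
        exact ⟨_, hNn.conj_mem x hx (SemidirectProduct.inr g), by simp⟩
      · rintro _ ⟨x, hx, rfl⟩ s hs
        have := hNs x hx s hs
        simp [hNker x hx] at this
        exact (mul_inv_eq_one.1 this).symm
    intro x hx
    have : x.left ∈ B := ⟨x, hx, rfl⟩
    rw [hB, Subgroup.mem_bot] at this
    exact ⟨this, hNker x hx⟩

/-- If the boundary condition fails, then some group has an element of the intersection of the
`𝔑_π ∘ F`-maximal subgroups outside the terminal norm. -/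
theorem exists_not_maximalInter_le_of_not_boundaryConditionIII (hF : F.IsFormation)
    (hS : F.IsSubgroupClosed) (h : ¬ BoundaryConditionIII π F) :
    ∃ (W : Type u) (_ : Group W) (_ : Finite W),
      ¬ ((piNilpotent π).formationProduct F).maximalInter W ≤ piNormInfty πᶜ F W := by
  simp only [BoundaryConditionIII, not_forall] at h
  obtain ⟨p, hp, G, _, _, hcrit, hGX⟩ := h
  have := Fact.mk p.2
  have hnp : ¬ (piGroups {p}).Mem (F.residual G) := hcrit.1
  simp only [piGroups, not_forall] at hnp
  obtain ⟨q, hqd, hqp⟩ := hnp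
  have := Fact.mk q.2
  obtain ⟨g, hg⟩ := exists_prime_orderOf_dvd_card' (q : ℕ) hqd
  have hqp' : (q : ℕ).Coprime p := (Nat.coprime_primes q.2 p.2).2 fun h => hqp (Subtype.ext h)
  have hgq : (g : G) ^ (q : ℕ) = 1 := by
    have h1 := pow_orderOf_eq_one g
    rw [hg] at h1
    exact congrArg Subtype.val h1
  have hg1 : (g : G) ≠ 1 := by
    intro h1
    rw [show g = 1 from Subtype.ext h1, orderOf_one] at hg
    exact q.2.one_lt.ne hg
  obtain ⟨V, _, _, φ, hV, hφ, hφg⟩ := exists_actsIrreducibly hqp' hgq hg1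
  refine ⟨V ⋊[φ] G, inferInstance, inferInstance, fun hle => hφg ?_⟩
  have hle2 := (inl_range_le_maximalInter (φ := φ) hF hS hcrit hGX hV).trans hle
  ext v
  obtain ⟨i, hi⟩ := (Subgroup.mem_iSup_of_directed
    (normSeries_mono (piGroups πᶜ) F (V ⋊[φ] G)).directed_le).1 (hle2 ⟨v, rfl⟩)
  have hv : v = 1 :=
    (normSeries_semidirectProduct hF hS hp hV hφ ⟨g, g.2, hφg⟩ i _ hi).1
  rw [hv, map_one, map_one]

end GroupClass

theorem theoremC (π : Set Nat.Primes) (F : GroupClass.{u}) (hF : F.IsFormation)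
    (hS : F.IsSubgroupClosed) :
    List.TFAE [
      ∀ (G : Type u) [Group G] [Finite G],
        GroupClass.piNormInfty πᶜ F G =
          ((GroupClass.piNilpotent π).formationProduct F).maximalInter G,
      ∀ (G : Type u) [Group G] [Finite G],
        GroupClass.hypercentre π (GroupClass.nilpotent.formationProduct F) G =
          ((GroupClass.piNilpotent π).formationProduct F).maximalInter G,
      GroupClass.BoundaryConditionIII π F] := by
  tfae_have 1 → 3 := by
    intro h
    by_contra h3
    obtain ⟨W, _, _, hW⟩ :=
      GroupClass.exists_not_maximalInter_le_of_not_boundaryConditionIII hF hS h3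
    exact hW (h W).ge
  tfae_have 2 → 3 := by
    intro h
    by_contra h3
    obtain ⟨W, _, _, hW⟩ :=
      GroupClass.exists_not_maximalInter_le_of_not_boundaryConditionIII hF hS h3
    exact hW ((h W).ge.trans (sSup_le fun N hN => hN.le_piNormInfty hF hS))
  tfae_have 3 → 1 := fun h G _ _ =>
    le_antisymm (GroupClass.piNormInfty_le_maximalInter hF hS h)
      ((GroupClass.isHypercentral_maximalInter hF hS h).le_piNormInfty hF hS)
  tfae_have 3 → 2 := fun h G _ _ =>
    le_antisymm (sSup_le fun N hN => hN.le_maximalInter hF hS)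
      (le_sSup (GroupClass.isHypercentral_maximalInter hF hS h))
  tfae_finish
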